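/- All Hilbert spaces are finite-dimensional and nonzero. For an operator $X$ let $\|X\|_1=\operatorname{Tr}\sqrt{X^\dagger X}$, and for a linear superoperator $\Gamma$ on the operators on $A$ let $$\|\Gamma\|_\diamond^{(k)}=\max\{\|(\mathrm{Id}_k\otimes\Gamma)(X)\|_1 : X \text{ an operator on } \mathbb{C}^k\otimes A,\ \|X\|_1\le 1\},\qquad \|\Gamma\|_\diamond=\sup_k\|\Gamma\|_\diamond^{(k)}.$$ A channel is a completely positive trace-preserving linear map, and $S(H)$ is the set of density operators on $H$. Let $\mathcal N:S(A)\to S(B)$ be a channel, let $V:A\to B\otimes E$ be an isometry with $\mathcal N(\rho)=\operatorname{Tr}_E V\rho V^\dagger$, and let $\mathcal N^c(\rho)=\operatorname{Tr}_B V\rho V^\dagger$ be the complementary channel. For $\rho\in S(A)$ let $\mathcal R_\rho$ be the channel that takes every state to $\mathcal N^c(\rho)$. Say that a nonzero subspace $\tilde A\subseteq A$ is decodable with error $\delta$ if there is a channel $\tilde{\mathcal D}:S(B)\to S(\tilde A)$ with $\|\tilde{\mathcal D}\circ\tilde{\mathcal N}-\mathrm{Id}\|_\diamond\le\delta$, where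 $\tilde{\mathcal N}$ is the restriction of $\mathcal N$ to $S(\tilde A)$. Let $\varepsilon,\delta\ge 0$ and let $k$ be a natural number. (1) If $\|\mathcal N^c-\mathcal R_\rho\|_\diamond^{(k)}\le\varepsilon$ for some state $\rho\in S(A)$, then every nonzero subspace $\tilde A\subseteq A$ of dimension at most $k$ is decodable with error $2\sqrt{2\varepsilon}$. (2) Conversely, if $k\ge 3$ and every nonzero subspace of $A$ of dimension less than $k$ is decodable with error $\delta$, then $\|\mathcal N^c-\mathcal R_\rho\|_\diamond^{(k)}\le 8\sqrt\delta$ for some state $\rho\in S(A)$. The same conclusion holds if $k\ge 2$ and every nonzero subspace of dimension at most $k$ is decodable with error $\delta$. -/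

import Mathlib

open scoped Matrix NNReal ENNReal ComplexOrder

/-- Superoperators: linear maps from operators on `ℂ^A` to operators on `ℂ^B`. -/
abbrev Superop (A B : Type*) := Matrix A A ℂ →ₗ[ℂ] Matrix B B ℂ

/-- `Id_R ⊗ Γ`: the superoperator `Γ` applied to each `A`-block of an operator on `ℂ^R ⊗ ℂ^A`. -/
def idTensor {A B : Type*} (R : Type*) (Γ : Superop A B) : Superop (R × A) (R × B) where
  toFun X := Matrix.of fun p q => Γ (Matrix.of fun a a' => X (p.1, a) (q.1, a')) p.2 q.2
  map_add' X Y := by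
    ext p q
    have h : (Matrix.of fun a a' => (X + Y) (p.1, a) (q.1, a')) =
        (Matrix.of fun a a' => X (p.1, a) (q.1, a')) +
          (Matrix.of fun a a' => Y (p.1, a) (q.1, a')) := rfl
    simp only [Matrix.of_apply, Matrix.add_apply] at h ⊢
    rw [h, map_add, Matrix.add_apply]
  map_smul' c X := by
    ext p q
    have h : (Matrix.of fun a a' => (c • X) (p.1, a) (q.1, a')) =
        c • (Matrix.of fun a a' => X (p.1, a) (q.1, a')) := rfl
    simp only [Matrix.of_apply, Matrix.smul_apply, RingHom.id_apply] at h ⊢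
    rw [h, map_smul, Matrix.smul_apply]

/-- A quantum channel: a completely positive, trace-preserving linear map. -/
structure IsChannel {A B : Type*} [Fintype A] [Fintype B] (Φ : Superop A B) : Prop where
  completelyPositive : ∀ (n : ℕ) (X : Matrix (Fin n × A) (Fin n × A) ℂ),
    X.PosSemidef → (idTensor (Fin n) Φ X).PosSemidef
  tracePreserving : ∀ X : Matrix A A ℂ, (Φ X).trace = X.trace

/-- Density operators on `ℂ^A`. -/
structure IsDensity {A : Type*} [Fintype A] (ρ : Matrix A A ℂ) : Prop where
  posSemidef : ρ.PosSemidef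
  trace_eq_one : ρ.trace = 1

/-- The trace norm `‖X‖₁`: the sum of the singular values of `X`. -/
noncomputable def traceNorm {A : Type*} [Fintype A] [DecidableEq A] (X : Matrix A A ℂ) : ℝ :=
  ∑ i, √((Matrix.isHermitian_conjTranspose_mul_self X).eigenvalues i)

/-- The `k`-diamond norm, the supremum of `‖(Id_k ⊗ Γ) X‖₁` over all operators `X` on `ℂ^k ⊗ ℂ^A`
with `‖X‖₁ ≤ 1`. It takes values in `[0, ∞]`, so that the supremum is a genuine one. -/
noncomputable def kDiamondNorm {A B : Type*} [Fintype A] [DecidableEq A] [Fintype B]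
    [DecidableEq B] (k : ℕ) (Γ : Superop A B) : ℝ≥0∞ :=
  ⨆ (X : Matrix (Fin k × A) (Fin k × A) ℂ) (_ : traceNorm X ≤ 1),
    ENNReal.ofReal (traceNorm (idTensor (Fin k) Γ X))

/-- The diamond norm. -/
noncomputable def diamondNorm {A B : Type*} [Fintype A] [DecidableEq A] [Fintype B]
    [DecidableEq B] (Γ : Superop A B) : ℝ≥0∞ :=
  ⨆ k : ℕ, kDiamondNorm k Γ

/-- Conjugation `X ↦ V X V†`. -/
def conjBy {A C : Type*} [Fintype A] (V : Matrix C A ℂ) : Superop A C where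
  toFun X := V * X * Vᴴ
  map_add' X Y := by rw [Matrix.mul_add, Matrix.add_mul]
  map_smul' c X := by simp

/-- The partial trace over the second factor, `Tr_E`. -/
def traceOutSnd {B E : Type*} [Fintype E] : Superop (B × E) B where
  toFun Y := Matrix.of fun b b' => ∑ e, Y (b, e) (b', e)
  map_add' X Y := by ext; simp [Finset.sum_add_distrib]
  map_smul' c X := by ext; simp [Finset.mul_sum]

/-- The partial trace over the first factor, `Tr_B`. -/
def traceOutFst {B E : Type*} [Fintype B] : Superop (B × E) E where
  toFun Y := Matrix.of fun e e' => ∑ b, Y (b, e) (b, e')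
  map_add' X Y := by ext; simp [Finset.sum_add_distrib]
  map_smul' c X := by ext; simp [Finset.mul_sum]

/-- `V : ℂ^A → ℂ^B ⊗ ℂ^E` is an isometric extension (Stinespring dilation) of `N`:
`V† V = 1` and `N X = Tr_E (V X V†)`. -/
structure IsIsometricExtension {A B E : Type*} [Fintype A] [DecidableEq A] [Fintype B] [Fintype E]
    (V : Matrix (B × E) A ℂ) (N : Superop A B) : Prop where
  isometry : Vᴴ * V = 1
  eq_traceOut : ∀ X : Matrix A A ℂ, N X = traceOutSnd (conjBy V X)

/-- The complementary channel `X ↦ Tr_B (V X V†)` determined by an isometric extension `V`. -/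
def complementary {A B E : Type*} [Fintype A] [Fintype B] (V : Matrix (B × E) A ℂ) :
    Superop A E :=
  traceOutFst ∘ₗ conjBy V

/-- The constant superoperator `X ↦ Tr(X) σ`, which takes every state to `σ`. -/
def constantTo {A E : Type*} [Fintype A] (σ : Matrix E E ℂ) : Superop A E :=
  (Matrix.traceLinearMap A ℂ ℂ).smulRight σ

/-- The matrix of the inclusion of a subspace `S ⊆ ℂ^A`, with respect to an orthonormal basis
of `S`; it identifies `S` isometrically with `ℂ^(dim S)`. -/
noncomputable def inclusionMatrix {A : Type*} [Fintype A]
    (S : Submodule ℂ (EuclideanSpace ℂ A)) : Matrix A (Fin (Module.finrank ℂ S)) ℂ :=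
  Matrix.of fun a i => (stdOrthonormalBasis ℂ S i : EuclideanSpace ℂ A) a

/-- The restriction of `N` to operators on a subspace `S`. -/
noncomputable def restrictTo {A B : Type*} [Fintype A] (N : Superop A B)
    (S : Submodule ℂ (EuclideanSpace ℂ A)) : Superop (Fin (Module.finrank ℂ S)) B :=
  N ∘ₗ conjBy (inclusionMatrix S)

/-- The subspace `S` can be decoded from the output of `N` with diamond-norm error at most `δ`:
there is a channel `D` from operators on `ℂ^B` to operators on `S` such that
`‖D ∘ N|_S - Id‖_⋄ ≤ δ`. -/
def DecodableWithError {A B : Type*} [Fintype A] [Fintype B] (N : Superop A B)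
    (S : Submodule ℂ (EuclideanSpace ℂ A)) (δ : ℝ≥0) : Prop :=
  ∃ D : Superop B (Fin (Module.finrank ℂ S)),
    IsChannel D ∧ diamondNorm (D ∘ₗ restrictTo N S - LinearMap.id) ≤ δ

set_option linter.unusedSectionVars false

/-! A vector of `ℂ^R ⊗ ℂ^A` is encoded by its coefficient matrix `Φ`, so `hsSq Φ` is its squared
norm, and partial traces of `|φ⟩⟨ψ|` become products `X * Yᴴ` of reshaped matrices. The trace norm
is handled by duality with contractions. A singular value decomposition reduces k-diamond norms to
rank-one inputs `ketBra Φ Ψ`.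

From forgetfulness to decoding. A purified state of the subspace is sent to a reference–environment
state within `ε` of a product. By Uhlmann's theorem and the Powers–Størmer inequality
(`exists_isContraction_le_re_trace`), some contraction on the purifying system reaches overlap at
least `1 - ε / 2` with the ideal purification. This overlap is bilinear in the contraction and the
state, so Sion's minimax theorem gives one contraction that serves all states. Completed to a
channel, it composes with `N` to Kraus operators close to multiples `w i • 1` of the identity, hence
diamond-norm error at most `2√ε`.

From decoding to forgetfulness. Dilate the decoder, and let `M i` be the Kraus operators of decoder
after channel. Every state has entanglement fidelity `∑ i, ‖Tr (M i ρ)‖²` at least `1 - δ/2`. Take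
for `w` the point of minimal norm in the convex set of vectors `(Tr (M i ρ))ᵢ`: its first-order
condition gives `∑ i, hsSq (M i * Θ - w i • Θ) ≤ δ/2 * hsSq Θ` for all `Θ` at once. So on each
decodable subspace the complement is within `√2 √δ` of a constant map to some `ω`. At the minimizing
state the cross terms cancel, and its output is even within `δ/2` of `ω`.

Gluing the subspaces. Any two pure states lie in a common subspace of dimension at most two, so all
outputs lie within `2√2 √δ` of one fixed output `σ`. For general `Φ`, `Ψ`, diagonalize `Ψᴴ * Φ` by a
singular value decomposition and cut `Φ` into three parts and `Ψ` into four; a pair of parts lives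
in dimension at most `⌈k/3⌉ + ⌈k/4⌉`. Cauchy–Schwarz costs `√3 √4` for the local errors. The
corrections from `ω` to `σ` see only the Gram matrices of the pairs, which are disjoint pieces of a
diagonal matrix, so they sum at no cost. The total is `√2 √12 √δ + 2√2 √δ + δ/2`, at most `8√δ` when
`δ ≤ 1/16`; for larger `δ` the trivial bound `2` suffices. -/

/-- The squared Hilbert–Schmidt norm of a complex matrix. -/
noncomputable def hsSq {m n : Type*} [Fintype m] [Fintype n] (X : Matrix m n ℂ) : ℝ :=
  ∑ i, ∑ j, ‖X i j‖ ^ 2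

/-- `W` is a contraction for the Euclidean norms: `W† W ≤ 1`. -/
def IsContraction {m n : Type*} [Fintype m] [Fintype n] [DecidableEq n] (W : Matrix m n ℂ) : Prop :=
  (1 - Wᴴ * W).PosSemidef

/-! ### Hilbert–Schmidt norm and contractions. -/

section HilbertSchmidt

variable {l m n : Type*} [Fintype l] [Fintype m] [Fintype n]

theorem hsSq_nonneg (X : Matrix m n ℂ) : 0 ≤ hsSq X :=
  Finset.sum_nonneg fun _ _ => Finset.sum_nonneg fun _ _ => by positivity

theorem trace_conjTranspose_mul_self (X : Matrix m n ℂ) : (Xᴴ * X).trace = hsSq X := by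
  simp only [Matrix.trace, Matrix.diag, Matrix.mul_apply, Matrix.conjTranspose_apply, hsSq]
  rw [Finset.sum_comm]
  push_cast
  refine Finset.sum_congr rfl fun i _ => Finset.sum_congr rfl fun j _ => ?_
  simpa using Complex.conj_mul' (X i j)

theorem hsSq_eq_re_trace (X : Matrix m n ℂ) : hsSq X = ((Xᴴ * X).trace).re := by
  rw [trace_conjTranspose_mul_self, Complex.ofReal_re]

theorem hsSq_conjTranspose (X : Matrix m n ℂ) : hsSq Xᴴ = hsSq X := by
  simp only [hsSq, Matrix.conjTranspose_apply, norm_star]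
  exact Finset.sum_comm

theorem hsSq_transpose (X : Matrix m n ℂ) : hsSq Xᵀ = hsSq X := by
  simp only [hsSq, Matrix.transpose_apply]
  exact Finset.sum_comm

theorem hsSq_zero : hsSq (0 : Matrix m n ℂ) = 0 := by simp [hsSq]

theorem norm_trace_conjTranspose_mul_le (Y X : Matrix m n ℂ) :
    ‖(Yᴴ * X).trace‖ ≤ √(hsSq Y) * √(hsSq X) := by
  have h1 : (Yᴴ * X).trace = ∑ p : m × n, star (Y p.1 p.2) * X p.1 p.2 := by
    simp only [Matrix.trace, Matrix.diag, Matrix.mul_apply, Matrix.conjTranspose_apply]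
    rw [Finset.sum_comm, Fintype.sum_prod_type]
  have h2 : ∀ Z : Matrix m n ℂ, hsSq Z = ∑ p : m × n, ‖Z p.1 p.2‖ ^ 2 := fun Z => by
    rw [Fintype.sum_prod_type]; rfl
  rw [h1, h2, h2]
  refine (norm_sum_le _ _).trans ?_
  simp only [norm_mul, norm_star]
  exact Real.sum_mul_le_sqrt_mul_sqrt _ _ _

theorem hsSq_mul_of_isometry [DecidableEq n] {J : Matrix m n ℂ} (hJ : Jᴴ * J = 1)
    (X : Matrix n l ℂ) : hsSq (J * X) = hsSq X := by
  rw [hsSq_eq_re_trace, hsSq_eq_re_trace, Matrix.conjTranspose_mul, Matrix.mul_assoc,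
    ← Matrix.mul_assoc Jᴴ, hJ, Matrix.one_mul]

theorem IsContraction.hsSq_mul_le [DecidableEq n] {W : Matrix m n ℂ} (hW : IsContraction W)
    (X : Matrix n l ℂ) : hsSq (W * X) ≤ hsSq X := by
  have h := (hW.conjTranspose_mul_mul_same X).trace_nonneg
  have h' : (Xᴴ * (1 - Wᴴ * W) * X).trace = ((hsSq X - hsSq (W * X) : ℝ) : ℂ) := by
    rw [Complex.ofReal_sub, ← trace_conjTranspose_mul_self, ← trace_conjTranspose_mul_self,
      ← Matrix.trace_sub, Matrix.conjTranspose_mul]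
    congr 1
    simp only [Matrix.mul_sub, Matrix.sub_mul, Matrix.mul_one, Matrix.mul_assoc]
  rw [h', Complex.zero_le_real] at h
  linarith

theorem IsContraction.conjTranspose [DecidableEq m] [DecidableEq n] {W : Matrix m n ℂ}
    (hW : IsContraction W) : IsContraction Wᴴ := by
  -- A sum-of-squares certificate: both summands on the right are visibly positive.
  have h : 1 - Wᴴᴴ * Wᴴ = (1 - W * Wᴴ)ᴴ * (1 - W * Wᴴ) + W * (1 - Wᴴ * W) * Wᴴ := by
    simp only [Matrix.conjTranspose_conjTranspose, Matrix.conjTranspose_sub,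
      Matrix.conjTranspose_one, Matrix.conjTranspose_mul, Matrix.mul_sub, Matrix.sub_mul,
      Matrix.mul_one, Matrix.one_mul, Matrix.mul_assoc]
    abel
  unfold IsContraction
  rw [h]
  exact (Matrix.posSemidef_conjTranspose_mul_self _).add (hW.mul_mul_conjTranspose_same W)

theorem isContraction_of_isometry [DecidableEq n] {W : Matrix m n ℂ} (hW : Wᴴ * W = 1) :
    IsContraction W := by
  unfold IsContraction
  rw [hW, sub_self]
  exact Matrix.PosSemidef.zero

theorem IsContraction.mul [DecidableEq n] [DecidableEq l] {W : Matrix m n ℂ} (hW : IsContraction W)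
    {T : Matrix n l ℂ} (hT : IsContraction T) : IsContraction (W * T) := by
  have h : 1 - (W * T)ᴴ * (W * T) = (1 - Tᴴ * T) + Tᴴ * (1 - Wᴴ * W) * T := by
    simp only [Matrix.conjTranspose_mul, Matrix.mul_sub, Matrix.sub_mul, Matrix.mul_one,
      Matrix.mul_assoc]
    abel
  unfold IsContraction
  rw [h]
  exact hT.add (hW.conjTranspose_mul_mul_same T)

end HilbertSchmidt

/-! ### Trace norm and its duality with contractions. -/

section TraceNorm

variable {m n : Type*} [Fintype m] [Fintype n] [DecidableEq n]

/-- This serves as the singular value decomposition: the columns of `X * U` are orthogonal, and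
their lengths are the singular values. -/
theorem conjTranspose_mul_self_eigenvectorUnitary (X : Matrix m n ℂ) :
    let U : Matrix n n ℂ := (Matrix.isHermitian_conjTranspose_mul_self X).eigenvectorUnitary
    (X * U)ᴴ * (X * U) = Matrix.diagonal fun i =>
      (((Matrix.isHermitian_conjTranspose_mul_self X).eigenvalues i : ℝ) : ℂ) := by
  intro U
  have h := (Matrix.isHermitian_conjTranspose_mul_self X).conjStarAlgAut_star_eigenvectorUnitary
  rw [Unitary.conjStarAlgAut_star_apply] at h
  rw [Matrix.conjTranspose_mul, Matrix.mul_assoc, ← Matrix.mul_assoc Xᴴ, ← Matrix.mul_assoc]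
  exact h

/-- In an eigenbasis `u i` of `Xᴴ * X` the trace is the sum of `⟨u i, W X u i⟩`, and each term is at
most `‖X u i‖`, a singular value. -/
theorem norm_trace_mul_le_traceNorm {W : Matrix n n ℂ} (hW : IsContraction W) (X : Matrix n n ℂ) :
    ‖(W * X).trace‖ ≤ traceNorm X := by
  set U := (Matrix.isHermitian_conjTranspose_mul_self X).eigenvectorUnitary with hU
  have hY := conjTranspose_mul_self_eigenvectorUnitary X
  simp only [← hU] at hY
  set Y := X * (U : Matrix n n ℂ) with hYdef
  have hUU : (U : Matrix n n ℂ) * (U : Matrix n n ℂ)ᴴ = 1 := Unitary.coe_mul_star_self U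
  have hUU' : (U : Matrix n n ℂ)ᴴ * (U : Matrix n n ℂ) = 1 := Unitary.coe_star_mul_self U
  have h1 : (W * X).trace = ((U : Matrix n n ℂ)ᴴ * (W * Y)).trace := by
    rw [Matrix.trace_mul_comm (U : Matrix n n ℂ)ᴴ, hYdef, Matrix.mul_assoc, Matrix.mul_assoc, hUU,
      Matrix.mul_one]
  rw [h1, Matrix.trace, traceNorm]
  refine (norm_sum_le _ _).trans (Finset.sum_le_sum fun i _ => ?_)
  have hcs : ‖((U : Matrix n n ℂ)ᴴ * (W * Y)).diag i‖ ≤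
      √(∑ a, ‖(U : Matrix n n ℂ) a i‖ ^ 2) * √(∑ a, ‖(W * Y) a i‖ ^ 2) := by
    simp only [Matrix.diag, Matrix.mul_apply (M := (U : Matrix n n ℂ)ᴴ), Matrix.conjTranspose_apply]
    refine (norm_sum_le _ _).trans ?_
    simp only [norm_mul, norm_star]
    exact Real.sum_mul_le_sqrt_mul_sqrt _ _ _
  have hcol : ∀ Z : Matrix n n ℂ, (((∑ a, ‖Z a i‖ ^ 2 : ℝ)) : ℂ) = (Zᴴ * Z) i i := fun Z => by
    simp only [Matrix.mul_apply, Matrix.conjTranspose_apply]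
    push_cast
    exact Finset.sum_congr rfl fun a _ => by simpa using (Complex.conj_mul' (Z a i)).symm
  have hU1 : ∑ a, ‖(U : Matrix n n ℂ) a i‖ ^ 2 = 1 := by
    have := hcol U
    rw [hUU', Matrix.one_apply_eq] at this
    exact_mod_cast this
  have hY1 : ∑ a, ‖Y a i‖ ^ 2 = (Matrix.isHermitian_conjTranspose_mul_self X).eigenvalues i := by
    have := hcol Y
    rw [hY, Matrix.diagonal_apply_eq] at this
    exact_mod_cast this
  have hWY : ∑ a, ‖(W * Y) a i‖ ^ 2 ≤ ∑ a, ‖Y a i‖ ^ 2 := by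
    have h := (hW.conjTranspose_mul_mul_same Y).diag_nonneg (i := i)
    have h' : Yᴴ * (1 - Wᴴ * W) * Y = Yᴴ * Y - (W * Y)ᴴ * (W * Y) := by
      simp only [Matrix.conjTranspose_mul, Matrix.mul_sub, Matrix.sub_mul, Matrix.mul_one,
        Matrix.mul_assoc]
    rw [h', Matrix.sub_apply, ← hcol, ← hcol, ← Complex.ofReal_sub, Complex.zero_le_real] at h
    linarith
  refine hcs.trans ?_
  rw [hU1, Real.sqrt_one, one_mul, ← hY1]
  exact Real.sqrt_le_sqrt hWY

theorem exists_isContraction_trace_mul_eq_traceNorm (X : Matrix n n ℂ) :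
    ∃ W : Matrix n n ℂ, IsContraction W ∧ (W * X).trace = traceNorm X := by
  set U := (Matrix.isHermitian_conjTranspose_mul_self X).eigenvectorUnitary with hU
  have hY := conjTranspose_mul_self_eigenvectorUnitary X
  simp only [← hU] at hY
  set ev := (Matrix.isHermitian_conjTranspose_mul_self X).eigenvalues with hev
  set Y := X * (U : Matrix n n ℂ) with hYdef
  have hUU : (U : Matrix n n ℂ) * (U : Matrix n n ℂ)ᴴ = 1 := Unitary.coe_mul_star_self U
  have hUU' : (U : Matrix n n ℂ)ᴴ * (U : Matrix n n ℂ) = 1 := Unitary.coe_star_mul_self U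
  have hnn : ∀ i, 0 ≤ ev i := Matrix.eigenvalues_conjTranspose_mul_self_nonneg X
  set D : Matrix n n ℂ := Matrix.diagonal fun i => (((√(ev i))⁻¹ : ℝ) : ℂ) with hD
  have hXY : X = Y * (U : Matrix n n ℂ)ᴴ := by
    rw [hYdef, Matrix.mul_assoc, hUU, Matrix.mul_one]
  -- The adjoint of the partial isometry in the polar decomposition of `X`. Since `0⁻¹ = 0` in `D`,
  -- the kernel of `X` needs no separate treatment.
  refine ⟨(U : Matrix n n ℂ) * D * Yᴴ, ?_, ?_⟩
  · have hDh : Dᴴ = D := by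
      rw [hD, Matrix.diagonal_conjTranspose]
      congr 1
      ext i
      simp
    have key : IsContraction (Y * D * (U : Matrix n n ℂ)ᴴ) := by
      unfold IsContraction
      have : 1 - (Y * D * (U : Matrix n n ℂ)ᴴ)ᴴ * (Y * D * (U : Matrix n n ℂ)ᴴ) =
          (U : Matrix n n ℂ) * (1 - D * (Yᴴ * Y) * D) * (U : Matrix n n ℂ)ᴴ := by
        simp only [Matrix.conjTranspose_mul, Matrix.conjTranspose_conjTranspose, hDh,
          Matrix.mul_sub, Matrix.sub_mul, Matrix.mul_one, Matrix.mul_assoc, hUU]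
      rw [this]
      refine Matrix.PosSemidef.mul_mul_conjTranspose_same ?_ _
      rw [hY, hD, Matrix.diagonal_mul_diagonal, Matrix.diagonal_mul_diagonal, ← Matrix.diagonal_one,
        Matrix.diagonal_sub, Matrix.posSemidef_diagonal_iff]
      intro i
      have h1 : (√(ev i))⁻¹ * ev i * (√(ev i))⁻¹ ≤ 1 := by
        rcases (hnn i).eq_or_lt with h | h
        · simp [← h]
        · have hs := Real.sqrt_pos.2 h
          rw [mul_comm (√(ev i))⁻¹ (ev i), mul_assoc, ← mul_inv, Real.mul_self_sqrt (hnn i),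
            mul_inv_cancel₀ h.ne']
      have h2 : (0 : ℂ) ≤ ((1 - (√(ev i))⁻¹ * ev i * (√(ev i))⁻¹ : ℝ) : ℂ) :=
        Complex.zero_le_real.2 (by linarith)
      push_cast at h2 ⊢
      exact h2
    have := key.conjTranspose
    simpa only [Matrix.conjTranspose_mul, Matrix.conjTranspose_conjTranspose, hDh,
      Matrix.mul_assoc] using this
  · have h1 : (U : Matrix n n ℂ) * D * Yᴴ * X = (U : Matrix n n ℂ) * (D * (Yᴴ * Y)) *
        (U : Matrix n n ℂ)ᴴ := by
      conv_lhs => rw [hXY]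
      simp only [Matrix.mul_assoc]
    rw [h1, Matrix.trace_mul_comm, ← Matrix.mul_assoc, hUU', Matrix.one_mul, hY, hD,
      Matrix.diagonal_mul_diagonal, Matrix.trace_diagonal, traceNorm]
    push_cast
    refine Finset.sum_congr rfl fun i _ => ?_
    rw [← Complex.ofReal_inv, ← Complex.ofReal_mul]
    congr 1
    rcases (hnn i).eq_or_lt with h | h
    · simp [← hev, ← h]
    · have hs := Real.sqrt_pos.2 h
      rw [inv_mul_eq_div, Real.div_sqrt]

/-- The supremum over contractions is attained. The norm inequalities below are proved by testing
against one contraction at a time. -/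
theorem traceNorm_le_of_forall {X : Matrix n n ℂ} {c : ℝ}
    (h : ∀ W : Matrix n n ℂ, IsContraction W → ‖(W * X).trace‖ ≤ c) : traceNorm X ≤ c := by
  obtain ⟨W, hW, hWX⟩ := exists_isContraction_trace_mul_eq_traceNorm X
  have := h W hW
  rw [hWX, Complex.norm_real, Real.norm_eq_abs] at this
  exact (le_abs_self _).trans this

theorem traceNorm_nonneg (X : Matrix n n ℂ) : 0 ≤ traceNorm X :=
  Finset.sum_nonneg fun _ _ => Real.sqrt_nonneg _

theorem traceNorm_add_le (X Y : Matrix n n ℂ) :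
    traceNorm (X + Y) ≤ traceNorm X + traceNorm Y :=
  traceNorm_le_of_forall fun W hW => by
    rw [Matrix.mul_add, Matrix.trace_add]
    exact (norm_add_le _ _).trans
      (add_le_add (norm_trace_mul_le_traceNorm hW X) (norm_trace_mul_le_traceNorm hW Y))

theorem traceNorm_neg (X : Matrix n n ℂ) : traceNorm (-X) = traceNorm X := by
  have h : ∀ Y : Matrix n n ℂ, traceNorm (-Y) ≤ traceNorm Y := fun Y =>
    traceNorm_le_of_forall fun W hW => by
      rw [Matrix.mul_neg, Matrix.trace_neg, norm_neg]
      exact norm_trace_mul_le_traceNorm hW Y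
  exact (h X).antisymm (by simpa using h (-X))

theorem traceNorm_sub_le (X Y : Matrix n n ℂ) :
    traceNorm (X - Y) ≤ traceNorm X + traceNorm Y := by
  rw [sub_eq_add_neg, ← traceNorm_neg Y]
  exact traceNorm_add_le _ _

theorem traceNorm_sub_comm (X Y : Matrix n n ℂ) : traceNorm (X - Y) = traceNorm (Y - X) := by
  rw [← traceNorm_neg, neg_sub]

theorem traceNorm_zero : traceNorm (0 : Matrix n n ℂ) = 0 :=
  le_antisymm (traceNorm_le_of_forall fun W _ => by simp) (traceNorm_nonneg _)

theorem traceNorm_sum_le {ι : Type*} (s : Finset ι) (X : ι → Matrix n n ℂ) :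
    traceNorm (∑ i ∈ s, X i) ≤ ∑ i ∈ s, traceNorm (X i) :=
  Finset.le_sum_of_subadditive _ traceNorm_zero.le traceNorm_add_le s X

theorem traceNorm_smul_le (c : ℂ) (X : Matrix n n ℂ) : traceNorm (c • X) ≤ ‖c‖ * traceNorm X :=
  traceNorm_le_of_forall fun W hW => by
    rw [Matrix.mul_smul, Matrix.trace_smul, smul_eq_mul, norm_mul]
    exact mul_le_mul_of_nonneg_left (norm_trace_mul_le_traceNorm hW X) (norm_nonneg c)

/-- Hölder's inequality: cycle the trace to `Tr (Yᴴ (W X))` and apply Cauchy–Schwarz, since `W` does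
not increase the norm of `X`. -/
theorem traceNorm_mul_conjTranspose_le (X Y : Matrix n m ℂ) :
    traceNorm (X * Yᴴ) ≤ √(hsSq X) * √(hsSq Y) :=
  traceNorm_le_of_forall fun W hW => by
    rw [← Matrix.mul_assoc, Matrix.trace_mul_comm]
    refine (norm_trace_conjTranspose_mul_le Y (W * X)).trans ?_
    rw [mul_comm]
    exact mul_le_mul_of_nonneg_right (Real.sqrt_le_sqrt (hW.hsSq_mul_le X)) (Real.sqrt_nonneg _)

/-- Two nearby pairs of purifications have nearby partial traces. -/
theorem traceNorm_mul_conjTranspose_sub_le (X X' Y Y' : Matrix n m ℂ) :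
    traceNorm (X * Yᴴ - X' * Y'ᴴ) ≤
      √(hsSq (X - X')) * √(hsSq Y) + √(hsSq X') * √(hsSq (Y - Y')) := by
  have h : X * Yᴴ - X' * Y'ᴴ = (X - X') * Yᴴ + X' * (Y - Y')ᴴ := by
    rw [Matrix.conjTranspose_sub, Matrix.sub_mul, Matrix.mul_sub]
    abel
  rw [h]
  exact (traceNorm_add_le _ _).trans
    (add_le_add (traceNorm_mul_conjTranspose_le _ _) (traceNorm_mul_conjTranspose_le _ _))

/-- A matrix is a sum of rank-one matrices whose trace norms add up to its trace norm. -/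
theorem exists_eq_sum_vecMulVec (X : Matrix n n ℂ) :
    ∃ x v : n → n → ℂ, X = ∑ i, Matrix.vecMulVec (x i) (star (v i)) ∧
      ∑ i, √(∑ a, ‖x i a‖ ^ 2) * √(∑ a, ‖v i a‖ ^ 2) = traceNorm X := by
  set U := (Matrix.isHermitian_conjTranspose_mul_self X).eigenvectorUnitary with hU
  have hY := conjTranspose_mul_self_eigenvectorUnitary X
  simp only [← hU] at hY
  set Y := X * (U : Matrix n n ℂ) with hYdef
  have hUU : (U : Matrix n n ℂ) * (U : Matrix n n ℂ)ᴴ = 1 := Unitary.coe_mul_star_self U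
  have hUU' : (U : Matrix n n ℂ)ᴴ * (U : Matrix n n ℂ) = 1 := Unitary.coe_star_mul_self U
  have hXY : X = Y * (U : Matrix n n ℂ)ᴴ := by
    rw [hYdef, Matrix.mul_assoc, hUU, Matrix.mul_one]
  have hcol : ∀ (Z : Matrix n n ℂ) i, (((∑ a, ‖Z a i‖ ^ 2 : ℝ)) : ℂ) = (Zᴴ * Z) i i := fun Z i => by
    simp only [Matrix.mul_apply, Matrix.conjTranspose_apply]
    push_cast
    exact Finset.sum_congr rfl fun a _ => by simpa using (Complex.conj_mul' (Z a i)).symm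
  refine ⟨fun i a => Y a i, fun i a => (U : Matrix n n ℂ) a i, ?_, ?_⟩
  · conv_lhs => rw [hXY]
    ext a b
    simp only [Matrix.mul_apply, Matrix.sum_apply, Matrix.vecMulVec_apply,
      Matrix.conjTranspose_apply, Pi.star_apply]
  · refine Finset.sum_congr rfl fun i _ => ?_
    have h1 := hcol U i
    have h2 := hcol Y i
    rw [hUU', Matrix.one_apply_eq] at h1
    rw [hY, Matrix.diagonal_apply_eq] at h2
    have h1' : ∑ a, ‖(U : Matrix n n ℂ) a i‖ ^ 2 = 1 := by exact_mod_cast h1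
    have h2' : ∑ a, ‖Y a i‖ ^ 2 =
      (Matrix.isHermitian_conjTranspose_mul_self X).eigenvalues i := by exact_mod_cast h2
    rw [h1', h2', Real.sqrt_one, mul_one]

end TraceNorm

/-! ### Bipartite vectors as matrices, and superoperators on rank-one inputs. -/

/-- The rank-one operator `|φ⟩⟨ψ|` on `ℂ^R ⊗ ℂ^A`, for vectors `φ`, `ψ` given by the matrices
`Φ`, `Ψ` of their coefficients. -/
def ketBra {R A : Type*} (Φ Ψ : Matrix A R ℂ) : Matrix (R × A) (R × A) ℂ :=
  Matrix.of fun p q => Φ p.2 p.1 * star (Ψ q.2 q.1)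

/-- The vector `(1 ⊗ V) φ` in `ℂ^R ⊗ ℂ^B ⊗ ℂ^E`, as a matrix from `ℂ^B` to `ℂ^R ⊗ ℂ^E`. -/
def toEnv {R A B E : Type*} [Fintype A] (V : Matrix (B × E) A ℂ) (Φ : Matrix A R ℂ) :
    Matrix (R × E) B ℂ :=
  Matrix.of fun p b => (V * Φ) (b, p.2) p.1

/-- The vector `(1 ⊗ M) φ` with `M = ∑ i, M i ⊗ |i⟩`, as a matrix from `ℂ^I` to `ℂ^R ⊗ ℂ^B`. -/
def krausStack {R A B I : Type*} [Fintype A] (M : I → Matrix B A ℂ) (Φ : Matrix A R ℂ) :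
    Matrix (R × B) I ℂ :=
  Matrix.of fun p i => (M i * Φ) p.2 p.1

/-- The superoperator `X ↦ ∑ i, M i X (M i)†`. -/
def krausMap {A B I : Type*} [Fintype A] [Fintype I] (M : I → Matrix B A ℂ) : Superop A B :=
  ∑ i, conjBy (M i)

section Algebra

variable {R A B E I : Type*}

theorem krausMap_apply [Fintype A] [Fintype I] (M : I → Matrix B A ℂ) (X : Matrix A A ℂ) :
    krausMap M X = ∑ i, M i * X * (M i)ᴴ := by
  simp [krausMap, conjBy]

theorem idTensor_sub_apply (Γ Γ' : Superop A B) (X : Matrix (R × A) (R × A) ℂ) :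
    idTensor R (Γ - Γ') X = idTensor R Γ X - idTensor R Γ' X := by
  ext p q
  simp [idTensor]

theorem idTensor_id_apply (X : Matrix (R × A) (R × A) ℂ) :
    idTensor R (LinearMap.id : Superop A A) X = X := by
  ext p q
  simp [idTensor]

theorem ketBra_block (Φ Ψ : Matrix A R ℂ) (r r' : R) :
    (Matrix.of fun a a' => ketBra Φ Ψ (r, a) (r', a')) =
      Matrix.vecMulVec (fun a => Φ a r) (star fun a => Ψ a r') := by
  ext a a'
  simp [ketBra, Matrix.vecMulVec_apply]

theorem idTensor_ketBra_apply (Γ : Superop A B) (Φ Ψ : Matrix A R ℂ) (p q : R × B) :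
    idTensor R Γ (ketBra Φ Ψ) p q =
      Γ (Matrix.vecMulVec (fun a => Φ a p.1) (star fun a => Ψ a q.1)) p.2 q.2 := by
  rw [← ketBra_block]
  rfl

theorem mul_vecMulVec_mul_conjTranspose_apply [Fintype A] (M M' : Matrix B A ℂ)
    (Φ Ψ : Matrix A R ℂ) (r r' : R) (b b' : B) :
    (M * Matrix.vecMulVec (fun a => Φ a r) (star fun a => Ψ a r') * M'ᴴ) b b' =
      (M * Φ) b r * star ((M' * Ψ) b' r') := by
  rw [Matrix.mul_vecMulVec, Matrix.vecMulVec_mul, Matrix.vecMulVec_apply]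
  congr 1
  simp only [Matrix.vecMul, dotProduct, Matrix.conjTranspose_apply, Pi.star_apply,
    Matrix.mul_apply, star_sum, star_mul']
  exact Finset.sum_congr rfl fun a _ => mul_comm _ _

/-- With `ℂ^B` as the column index, tracing it out is matrix multiplication. -/
theorem idTensor_complementary_ketBra [Fintype A] [Fintype B] (V : Matrix (B × E) A ℂ)
    (Φ Ψ : Matrix A R ℂ) :
    idTensor R (complementary V) (ketBra Φ Ψ) = toEnv V Φ * (toEnv V Ψ)ᴴ := by
  ext p q
  rw [idTensor_ketBra_apply]
  simp only [complementary, traceOutFst, conjBy, LinearMap.comp_apply, LinearMap.coe_mk,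
    AddHom.coe_mk, Matrix.of_apply, mul_vecMulVec_mul_conjTranspose_apply, toEnv]
  rw [Matrix.mul_apply]
  rfl

theorem idTensor_krausMap_ketBra [Fintype A] [Fintype I] (M : I → Matrix B A ℂ)
    (Φ Ψ : Matrix A R ℂ) :
    idTensor R (krausMap M) (ketBra Φ Ψ) = krausStack M Φ * (krausStack M Ψ)ᴴ := by
  ext p q
  rw [idTensor_ketBra_apply, krausMap_apply, Matrix.sum_apply, Matrix.mul_apply]
  simp only [mul_vecMulVec_mul_conjTranspose_apply]
  rfl

/-- The output depends on `Φ`, `Ψ` only through their Gram matrix. The final gluing argument rests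
on this. -/
theorem idTensor_constantTo_ketBra [Fintype A] (σ : Matrix E E ℂ) (Φ Ψ : Matrix A R ℂ) :
    idTensor R (constantTo σ) (ketBra Φ Ψ) =
      Matrix.kroneckerMap (· * ·) (Φᵀ * (Ψᵀ)ᴴ) σ := by
  ext p q
  rw [idTensor_ketBra_apply]
  simp only [constantTo, LinearMap.smulRight_apply, Matrix.traceLinearMap_apply,
    Matrix.trace_vecMulVec, Matrix.smul_apply, smul_eq_mul, Matrix.kroneckerMap_apply,
    Matrix.mul_apply, Matrix.transpose_apply, Matrix.conjTranspose_apply, dotProduct, Pi.star_apply]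

theorem hsSq_toEnv [Fintype R] [Fintype A] [DecidableEq A] [Fintype B] [Fintype E]
    {V : Matrix (B × E) A ℂ} (hV : Vᴴ * V = 1) (Φ : Matrix A R ℂ) : hsSq (toEnv V Φ) = hsSq Φ := by
  rw [← hsSq_mul_of_isometry hV Φ]
  simp only [hsSq, toEnv, Matrix.of_apply, Fintype.sum_prod_type]
  calc ∑ r, ∑ e, ∑ b, ‖(V * Φ) (b, e) r‖ ^ 2 = ∑ r, ∑ b, ∑ e, ‖(V * Φ) (b, e) r‖ ^ 2 :=
        Finset.sum_congr rfl fun _ _ => Finset.sum_comm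
    _ = ∑ b, ∑ r, ∑ e, ‖(V * Φ) (b, e) r‖ ^ 2 := Finset.sum_comm
    _ = ∑ b, ∑ e, ∑ r, ‖(V * Φ) (b, e) r‖ ^ 2 := Finset.sum_congr rfl fun _ _ => Finset.sum_comm

theorem hsSq_krausStack [Fintype R] [Fintype A] [Fintype B] [Fintype I]
    (M : I → Matrix B A ℂ) (Φ : Matrix A R ℂ) :
    hsSq (krausStack M Φ) = ∑ i, hsSq (M i * Φ) := by
  simp only [hsSq, krausStack, Matrix.of_apply, Fintype.sum_prod_type]
  calc ∑ r, ∑ b, ∑ i, ‖(M i * Φ) b r‖ ^ 2 = ∑ r, ∑ i, ∑ b, ‖(M i * Φ) b r‖ ^ 2 :=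
        Finset.sum_congr rfl fun _ _ => Finset.sum_comm
    _ = ∑ i, ∑ r, ∑ b, ‖(M i * Φ) b r‖ ^ 2 := Finset.sum_comm
    _ = ∑ i, ∑ b, ∑ r, ‖(M i * Φ) b r‖ ^ 2 := Finset.sum_congr rfl fun _ _ => Finset.sum_comm

end Algebra

/-! ### Reduction of the k-diamond norm to rank-one inputs. -/

section Diamond

variable {A B : Type*} [Fintype A] [DecidableEq A] [Fintype B] [DecidableEq B]

/-- The singular value decomposition writes the input as rank-one terms whose norms add up to its
trace norm. Inputs need not be Hermitian, so `Φ` and `Ψ` vary independently. -/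
theorem kDiamondNorm_le_of_ketBra {k : ℕ} {Γ : Superop A B} {c : ℝ≥0}
    (h : ∀ Φ Ψ : Matrix A (Fin k) ℂ,
      traceNorm (idTensor (Fin k) Γ (ketBra Φ Ψ)) ≤ c * (√(hsSq Φ) * √(hsSq Ψ))) :
    kDiamondNorm k Γ ≤ c := by
  refine iSup₂_le fun X hX => ?_
  rw [← ENNReal.ofReal_coe_nnreal]
  refine ENNReal.ofReal_le_ofReal ?_
  obtain ⟨x, v, hxv, hsum⟩ := exists_eq_sum_vecMulVec X
  have hX' : X =
      ∑ i, ketBra (Matrix.of fun a r => x i (r, a)) (Matrix.of fun a r => v i (r, a)) := by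
    rw [hxv]
    refine Finset.sum_congr rfl fun i _ => ?_
    ext p q
    simp [ketBra, Matrix.vecMulVec_apply]
  have hs : ∀ y : Fin k × A → ℂ,
      hsSq (Matrix.of fun (a : A) (r : Fin k) => y (r, a)) = ∑ p, ‖y p‖ ^ 2 := fun y => by
    simp only [hsSq, Matrix.of_apply, Fintype.sum_prod_type]
    exact Finset.sum_comm
  calc traceNorm (idTensor (Fin k) Γ X)
      ≤ ∑ i, traceNorm (idTensor (Fin k) Γ
          (ketBra (Matrix.of fun a r => x i (r, a)) (Matrix.of fun a r => v i (r, a)))) := by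
        conv_lhs => rw [hX', map_sum]
        exact traceNorm_sum_le _ _
    _ ≤ ∑ i, c * (√(∑ p, ‖x i p‖ ^ 2) * √(∑ p, ‖v i p‖ ^ 2)) :=
        Finset.sum_le_sum fun i _ => by
          have := h (Matrix.of fun a r => x i (r, a)) (Matrix.of fun a r => v i (r, a))
          rwa [hs, hs] at this
    _ = c * traceNorm X := by rw [← Finset.mul_sum, hsum]
    _ ≤ c := mul_le_of_le_one_right c.coe_nonneg hX

theorem ketBra_eq_mul_conjTranspose {R : Type*} (Φ Ψ : Matrix A R ℂ) :
    ketBra Φ Ψ = (Matrix.of fun (p : R × A) (_ : Unit) => Φ p.2 p.1) *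
      (Matrix.of fun (p : R × A) (_ : Unit) => Ψ p.2 p.1)ᴴ := by
  ext p q
  simp [ketBra, Matrix.mul_apply]

theorem traceNorm_ketBra_le {R : Type*} [Fintype R] [DecidableEq R] (Φ Ψ : Matrix A R ℂ) :
    traceNorm (ketBra Φ Ψ) ≤ √(hsSq Φ) * √(hsSq Ψ) := by
  rw [ketBra_eq_mul_conjTranspose]
  refine (traceNorm_mul_conjTranspose_le _ _).trans_eq ?_
  have hs : ∀ Z : Matrix A R ℂ,
      hsSq (Matrix.of fun (p : R × A) (_ : Unit) => Z p.2 p.1) = hsSq Z := fun Z => by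
    simp only [hsSq, Matrix.of_apply, Fintype.sum_prod_type, Finset.univ_unique,
      Finset.sum_singleton]
    exact Finset.sum_comm
  rw [hs, hs]

theorem traceNorm_idTensor_ketBra_le_of_kDiamondNorm_le {k : ℕ} {Γ : Superop A B} {c : ℝ≥0}
    (h : kDiamondNorm k Γ ≤ c) {Φ : Matrix A (Fin k) ℂ} (hΦ : hsSq Φ = 1) :
    traceNorm (idTensor (Fin k) Γ (ketBra Φ Φ)) ≤ c := by
  have hX : traceNorm (ketBra Φ Φ) ≤ 1 := by
    simpa [hΦ] using traceNorm_ketBra_le Φ Φ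
  have := (le_iSup₂ (f := fun (X : Matrix (Fin k × A) (Fin k × A) ℂ) (_ : traceNorm X ≤ 1) =>
    ENNReal.ofReal (traceNorm (idTensor (Fin k) Γ X))) (ketBra Φ Φ) hX).trans h
  rw [← ENNReal.ofReal_coe_nnreal] at this
  exact (ENNReal.ofReal_le_ofReal_iff c.coe_nonneg).1 this

/-- Split `T` into rank-one terms with norms adding up to `traceNorm T`; each term is then a product
to which Hölder's inequality applies. -/
theorem traceNorm_kronecker_le {R Q E : Type*} [Fintype R] [DecidableEq R] [Fintype Q]
    [Fintype E] [DecidableEq E] (G H : Matrix R Q ℂ) (T : Matrix E E ℂ) :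
    traceNorm (Matrix.kroneckerMap (· * ·) (G * Hᴴ) T) ≤
      √(hsSq G) * √(hsSq H) * traceNorm T := by
  obtain ⟨x, v, hxv, hsum⟩ := exists_eq_sum_vecMulVec T
  let lift : Matrix R Q ℂ → (E → ℂ) → Matrix (R × E) Q ℂ := fun G x =>
    Matrix.of fun p q => G p.1 q * x p.2
  have hlift : ∀ (G : Matrix R Q ℂ) (x : E → ℂ), hsSq (lift G x) = hsSq G * ∑ e, ‖x e‖ ^ 2 :=
    fun G x => by
      simp only [hsSq, lift, Matrix.of_apply, Fintype.sum_prod_type, norm_mul, mul_pow]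
      rw [Finset.sum_mul_sum]
      exact Finset.sum_congr rfl fun r _ => Finset.sum_congr rfl fun e _ => by
        rw [Finset.sum_mul]
  have hdec : Matrix.kroneckerMap (· * ·) (G * Hᴴ) T =
      ∑ i, lift G (x i) * (lift H (v i))ᴴ := by
    conv_lhs => rw [hxv]
    ext p q
    simp only [Matrix.kroneckerMap_apply, Matrix.sum_apply, Matrix.mul_apply,
      Matrix.vecMulVec_apply, Matrix.conjTranspose_apply, lift, Matrix.of_apply, Pi.star_apply,
      star_mul']
    rw [Finset.mul_sum]
    refine Finset.sum_congr rfl fun i _ => ?_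
    rw [Finset.sum_mul]
    exact Finset.sum_congr rfl fun q _ => by ring
  rw [hdec]
  refine (traceNorm_sum_le _ _).trans ?_
  rw [← hsum, Finset.mul_sum]
  refine Finset.sum_le_sum fun i _ => (traceNorm_mul_conjTranspose_le _ _).trans_eq ?_
  rw [hlift, hlift, Real.sqrt_mul (hsSq_nonneg _), Real.sqrt_mul (hsSq_nonneg _)]
  ring

end Diamond

/-! ### Kraus operators define channels. -/

section Kraus

variable {A B I : Type*} [Fintype A] [DecidableEq A] [Fintype B] [Fintype I]

theorem idTensor_conjBy {R : Type*} [Fintype R] [DecidableEq R] (M : Matrix B A ℂ)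
    (X : Matrix (R × A) (R × A) ℂ) :
    idTensor R (conjBy M) X = Matrix.kroneckerMap (· * ·) (1 : Matrix R R ℂ) M * X *
      (Matrix.kroneckerMap (· * ·) (1 : Matrix R R ℂ) M)ᴴ := by
  ext p q
  simp [idTensor, conjBy, Matrix.mul_apply, Fintype.sum_prod_type, Matrix.one_apply,
    Finset.sum_mul, apply_ite star]

theorem isChannel_krausMap {M : I → Matrix B A ℂ} (hM : ∑ i, (M i)ᴴ * M i = 1) :
    IsChannel (krausMap M) where
  completelyPositive n X hX := by
    have h : idTensor (Fin n) (krausMap M) X = ∑ i, idTensor (Fin n) (conjBy (M i)) X := by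
      ext p q
      simp [idTensor, krausMap, Matrix.sum_apply]
    rw [h]
    refine Matrix.posSemidef_sum _ fun i _ => ?_
    rw [idTensor_conjBy]
    exact hX.mul_mul_conjTranspose_same _
  tracePreserving X := by
    rw [krausMap_apply, Matrix.trace_sum]
    calc ∑ i, (M i * X * (M i)ᴴ).trace = ∑ i, ((M i)ᴴ * M i * X).trace :=
          Finset.sum_congr rfl fun i _ => by rw [Matrix.trace_mul_comm, Matrix.mul_assoc]
      _ = X.trace := by rw [← Matrix.trace_sum, ← Matrix.sum_mul, hM, Matrix.one_mul]

end Kraus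

/-! ### Compact convex sets of states and of contractions; minimax. -/

section Density

variable {m n : Type*} [Fintype m] [Fintype n] [DecidableEq n]

/-- Every positive semidefinite matrix has a positive semidefinite square root. -/
theorem exists_posSemidef_mul_self_eq {H : Matrix n n ℂ} (hH : H.PosSemidef) :
    ∃ a : Matrix n n ℂ, a.PosSemidef ∧ a * a = H := by
  set U := hH.1.eigenvectorUnitary with hU
  have hUU' : (U : Matrix n n ℂ)ᴴ * (U : Matrix n n ℂ) = 1 := Unitary.coe_star_mul_self U
  have hspec := hH.1.spectral_theorem
  rw [Unitary.conjStarAlgAut_apply] at hspec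
  refine ⟨(U : Matrix n n ℂ) * Matrix.diagonal (fun i => ((√(hH.1.eigenvalues i) : ℝ) : ℂ)) *
    (U : Matrix n n ℂ)ᴴ, ?_, ?_⟩
  · refine Matrix.PosSemidef.mul_mul_conjTranspose_same ?_ _
    rw [Matrix.posSemidef_diagonal_iff]
    exact fun i => Complex.zero_le_real.2 (Real.sqrt_nonneg _)
  · conv_rhs => rw [hspec]
    have hdiag : Matrix.diagonal (fun i => ((√(hH.1.eigenvalues i) : ℝ) : ℂ)) *
        Matrix.diagonal (fun i => ((√(hH.1.eigenvalues i) : ℝ) : ℂ)) =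
        Matrix.diagonal (RCLike.ofReal ∘ hH.1.eigenvalues : n → ℂ) := by
      rw [Matrix.diagonal_mul_diagonal]
      congr 1
      ext i
      rw [← Complex.ofReal_mul, Real.mul_self_sqrt (hH.eigenvalues_nonneg i)]
      rfl
    rw [← hdiag]
    change _ = (U : Matrix n n ℂ) * _ * (U : Matrix n n ℂ)ᴴ
    simp only [Matrix.mul_assoc]
    rw [← Matrix.mul_assoc (U : Matrix n n ℂ)ᴴ, hUU', Matrix.one_mul]

theorem isDensity_mul_conjTranspose {K : Matrix n m ℂ} (hK : hsSq K = 1) :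
    IsDensity (K * Kᴴ) where
  posSemidef := Matrix.posSemidef_self_mul_conjTranspose K
  trace_eq_one := by
    rw [Matrix.trace_mul_comm, trace_conjTranspose_mul_self, hK, Complex.ofReal_one]

theorem IsDensity.exists_eq_mul_conjTranspose {ρ : Matrix n n ℂ} (hρ : IsDensity ρ) :
    ∃ K : Matrix n n ℂ, hsSq K = 1 ∧ ρ = K * Kᴴ := by
  obtain ⟨K, hK, hKK⟩ := exists_posSemidef_mul_self_eq hρ.posSemidef
  have h : ρ = K * Kᴴ := by rw [hK.1.eq, hKK]
  refine ⟨K, ?_, h⟩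
  have ht := hρ.trace_eq_one
  rw [h, Matrix.trace_mul_comm, trace_conjTranspose_mul_self] at ht
  exact_mod_cast ht

theorem continuous_hsSq : Continuous (hsSq : Matrix m n ℂ → ℝ) := by
  unfold hsSq
  refine continuous_finsetSum _ fun i _ => continuous_finsetSum _ fun j _ => ?_
  exact ((continuous_apply_apply i j).norm).pow 2

theorem isCompact_setOf_hsSq_le (c : ℝ) : IsCompact {X : Matrix m n ℂ | hsSq X ≤ c} := by
  have hK : IsCompact (Set.univ.pi fun _ : m => Set.univ.pi fun _ : n =>
      Metric.closedBall (0 : ℂ) (√c)) :=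
    isCompact_univ_pi fun _ => isCompact_univ_pi fun _ => isCompact_closedBall _ _
  refine hK.of_isClosed_subset (isClosed_le continuous_hsSq continuous_const) ?_
  intro X hX i _ j _
  rw [mem_closedBall_zero_iff]
  refine Real.le_sqrt_of_sq_le (le_trans ?_ hX)
  exact (Finset.single_le_sum (f := fun j => ‖X i j‖ ^ 2) (fun _ _ => by positivity)
    (Finset.mem_univ j)).trans
    (Finset.single_le_sum (f := fun i => ∑ j, ‖X i j‖ ^ 2)
      (fun _ _ => Finset.sum_nonneg fun _ _ => by positivity) (Finset.mem_univ i))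

theorem isCompact_setOf_isDensity : IsCompact {ρ : Matrix n n ℂ | IsDensity ρ} := by
  -- States are the image of the Hilbert–Schmidt unit sphere under `K ↦ K * Kᴴ`, which gives
  -- compactness at once.
  have h : {ρ : Matrix n n ℂ | IsDensity ρ} =
      (fun K : Matrix n n ℂ => K * Kᴴ) '' {K | hsSq K = 1} := by
    ext ρ
    constructor
    · intro hρ
      obtain ⟨K, hK, rfl⟩ := hρ.exists_eq_mul_conjTranspose
      exact ⟨K, hK, rfl⟩
    · rintro ⟨K, hK, rfl⟩
      exact isDensity_mul_conjTranspose hK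
  rw [h]
  refine IsCompact.image ?_ (by fun_prop)
  exact (isCompact_setOf_hsSq_le 1).of_isClosed_subset
    (isClosed_eq continuous_hsSq continuous_const) fun K hK => le_of_eq hK

theorem convex_setOf_isDensity : Convex ℝ {ρ : Matrix n n ℂ | IsDensity ρ} := by
  intro ρ hρ τ hτ s t hs ht hst
  refine ⟨?_, ?_⟩
  · rw [← Complex.coe_smul, ← Complex.coe_smul]
    exact (hρ.posSemidef.smul (Complex.zero_le_real.2 hs)).add
      (hτ.posSemidef.smul (Complex.zero_le_real.2 ht))
  · rw [Matrix.trace_add, Matrix.trace_smul, Matrix.trace_smul, hρ.trace_eq_one, hτ.trace_eq_one,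
      ← add_smul, hst, one_smul]

theorem isDensity_single (i : n) : IsDensity (Matrix.single i i (1 : ℂ)) where
  posSemidef := by
    have := Matrix.posSemidef_self_mul_conjTranspose (Matrix.single i i (1 : ℂ))
    simpa using this
  trace_eq_one := by simp

theorem isClosed_setOf_posSemidef : IsClosed {X : Matrix n n ℂ | X.PosSemidef} := by
  have h : {X : Matrix n n ℂ | X.PosSemidef} =
      {X | Xᴴ = X} ∩ ⋂ x : n → ℂ, {X | 0 ≤ star x ⬝ᵥ (X *ᵥ x)} := by
    ext X
    simp only [Set.mem_ofPred_eq, Set.mem_inter_iff, Set.mem_iInter]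
    exact Matrix.posSemidef_iff_dotProduct_mulVec
  rw [h]
  refine (isClosed_eq (by fun_prop) continuous_id).inter (isClosed_iInter fun x => ?_)
  exact isClosed_le continuous_const (by fun_prop)

theorem isCompact_setOf_isContraction : IsCompact {W : Matrix m n ℂ | IsContraction W} := by
  refine (isCompact_setOf_hsSq_le (hsSq (1 : Matrix n n ℂ))).of_isClosed_subset ?_ ?_
  · exact isClosed_setOf_posSemidef.preimage
      (by fun_prop : Continuous fun W : Matrix m n ℂ => 1 - Wᴴ * W)
  · intro W hW
    simpa using hW.hsSq_mul_le (1 : Matrix n n ℂ)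

theorem convex_setOf_isContraction : Convex ℝ {W : Matrix m n ℂ | IsContraction W} := by
  intro W hW T hT s t hs ht hst
  have hs' : (0 : ℂ) ≤ (s : ℂ) := Complex.zero_le_real.2 hs
  have ht' : (0 : ℂ) ≤ (t : ℂ) := Complex.zero_le_real.2 ht
  have hst' : (s : ℂ) + t = 1 := by exact_mod_cast hst
  -- The variance identity for a convex combination; all three terms on the right are positive.
  have h : (1 : Matrix n n ℂ) - ((s : ℂ) • W + (t : ℂ) • T)ᴴ * ((s : ℂ) • W + (t : ℂ) • T) =
      (s : ℂ) • (1 - Wᴴ * W) + (t : ℂ) • (1 - Tᴴ * T) +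
        ((s : ℂ) * t) • ((W - T)ᴴ * (W - T)) := by
    have ht1 : (t : ℂ) = 1 - s := by rw [← hst']; ring
    simp only [Matrix.conjTranspose_add, Matrix.conjTranspose_smul, Matrix.conjTranspose_sub,
      Matrix.mul_add, Matrix.add_mul, Matrix.mul_sub, Matrix.sub_mul, Matrix.smul_mul,
      Matrix.mul_smul, RCLike.star_def, Complex.conj_ofReal]
    rw [ht1]
    module
  change IsContraction _
  unfold IsContraction
  rw [← Complex.coe_smul, ← Complex.coe_smul, h]
  exact ((hW.smul hs').add (hT.smul ht')).add
    ((Matrix.posSemidef_conjTranspose_mul_self _).smul (mul_nonneg hs' ht'))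

/-- Minimax for a bilinear function of a density operator and a contraction. -/
theorem exists_isContraction_forall_isDensity {p : Type*} [Fintype p] [DecidableEq p] [Nonempty p]
    (Z : Matrix m n ℂ →ₗ[ℂ] Matrix p p ℂ) {c : ℝ}
    (h : ∀ ρ, IsDensity ρ → ∃ C, IsContraction C ∧ c ≤ (Z C * ρ).trace.re) :
    ∃ C, IsContraction C ∧ ∀ ρ, IsDensity ρ → c ≤ (Z C * ρ).trace.re := by
  have hZ : Continuous Z := Z.continuous_of_finiteDimensional
  obtain ⟨ρ₀, hρ₀, C₀, hC₀, hsp⟩ := Sion.exists_isSaddlePointOn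
    (X := {ρ : Matrix p p ℂ | IsDensity ρ}) (Y := {C : Matrix m n ℂ | IsContraction C})
    (f := fun ρ C => (Z C * ρ).trace.re)
    ⟨_, isDensity_single (Classical.arbitrary p)⟩ convex_setOf_isDensity
    isCompact_setOf_isDensity
    (fun C _ => by
      refine Continuous.lowerSemicontinuous ?_ |>.lowerSemicontinuousOn _
      exact Complex.continuous_re.comp (by fun_prop))
    (fun C _ => ConvexOn.quasiconvexOn ⟨convex_setOf_isDensity, fun ρ _ τ _ s t _ _ _ => by
      simp [Matrix.mul_add, Matrix.trace_add]⟩)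
    convex_setOf_isContraction
    ⟨0, by
      change IsContraction _
      simp only [IsContraction, Matrix.conjTranspose_zero, Matrix.zero_mul, sub_zero]
      exact Matrix.PosSemidef.one⟩
    isCompact_setOf_isContraction
    (fun ρ _ => by
      refine Continuous.upperSemicontinuous ?_ |>.upperSemicontinuousOn _
      exact Complex.continuous_re.comp (by fun_prop))
    (fun ρ _ => ConcaveOn.quasiconcaveOn ⟨convex_setOf_isContraction, fun C _ T _ s t _ _ _ => by
      simp [← Complex.coe_smul, Matrix.add_mul, Matrix.trace_add]⟩)
  -- At the saddle point, `C₀` against any `ρ` does at least as well as any `C` against `ρ₀`; choose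
  -- the `C` that is good for `ρ₀`.
  refine ⟨C₀, hC₀, fun ρ hρ => ?_⟩
  obtain ⟨C, hC, hcC⟩ := h ρ₀ hρ₀
  exact hcC.trans (hsp ρ hρ C hC)

end Density

/-! ### The minimal overlap vector. -/

section MinimalNorm

variable {P I : Type*} [Fintype P] [DecidableEq P] [Fintype I]

/-- The point of minimal norm of the convex set of vectors `(Tr (M i ρ))ᵢ`. -/
theorem exists_isDensity_forall_le_inner [Nonempty P] (M : I → Matrix P P ℂ) :
    ∃ ρ₀ : Matrix P P ℂ, IsDensity ρ₀ ∧ ∀ ρ, IsDensity ρ →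
      ∑ i, ‖(M i * ρ₀).trace‖ ^ 2 ≤ (∑ i, star (M i * ρ₀).trace * (M i * ρ).trace).re := by
  have hcont : Continuous fun ρ : Matrix P P ℂ => ∑ i, ‖(M i * ρ).trace‖ ^ 2 := by fun_prop
  obtain ⟨ρ₀, hρ₀, hmin⟩ := isCompact_setOf_isDensity.exists_isMinOn
    ⟨_, isDensity_single (Classical.arbitrary P)⟩ hcont.continuousOn
  refine ⟨ρ₀, hρ₀, fun ρ hρ => ?_⟩
  set a : I → ℂ := fun i => (M i * ρ₀).trace with ha
  set b : I → ℂ := fun i => (M i * ρ).trace with hb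
  -- The squared norm along the segment from `ρ₀` to `ρ`. Minimality at `t = 0`, divided by `t` as
  -- `t → 0`, is the claimed inequality.
  have hexp : ∀ t : ℝ, ∑ i, ‖(1 - t) • a i + t • b i‖ ^ 2 =
      ∑ i, ‖a i‖ ^ 2 + 2 * t * ((∑ i, star (a i) * b i).re - ∑ i, ‖a i‖ ^ 2) +
        t ^ 2 * ∑ i, ‖b i - a i‖ ^ 2 := by
    intro t
    rw [Complex.re_sum, ← Finset.sum_sub_distrib, Finset.mul_sum, Finset.mul_sum,
      ← Finset.sum_add_distrib, ← Finset.sum_add_distrib]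
    refine Finset.sum_congr rfl fun i _ => ?_
    simp only [← Complex.normSq_eq_norm_sq, Complex.normSq_apply]
    simp
    ring
  have hpos : ∀ t : ℝ, 0 < t → t ≤ 1 →
      0 ≤ 2 * ((∑ i, star (a i) * b i).re - ∑ i, ‖a i‖ ^ 2) + t * ∑ i, ‖b i - a i‖ ^ 2 := by
    intro t ht0 ht1
    have hmem := convex_setOf_isDensity hρ₀ hρ (sub_nonneg.2 ht1) ht0.le (by ring)
    have hle : ∑ i, ‖a i‖ ^ 2 ≤ ∑ i, ‖(M i * ((1 - t) • ρ₀ + t • ρ)).trace‖ ^ 2 := hmin hmem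
    have heq : ∀ i, (M i * ((1 - t) • ρ₀ + t • ρ)).trace = (1 - t) • a i + t • b i := fun i => by
      rw [Matrix.mul_add, Matrix.trace_add, Matrix.mul_smul, Matrix.mul_smul, Matrix.trace_smul,
        Matrix.trace_smul]
    simp only [heq] at hle
    rw [hexp t] at hle
    have : 0 ≤ t * (2 * ((∑ i, star (a i) * b i).re - ∑ i, ‖a i‖ ^ 2) +
        t * ∑ i, ‖b i - a i‖ ^ 2) := by nlinarith
    exact nonneg_of_mul_nonneg_right this ht0
  have hlim : Filter.Tendsto (fun t : ℝ => 2 * ((∑ i, star (a i) * b i).re - ∑ i, ‖a i‖ ^ 2) +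
      t * ∑ i, ‖b i - a i‖ ^ 2) (nhdsWithin 0 (Set.Ioi 0))
      (nhds (2 * ((∑ i, star (a i) * b i).re - ∑ i, ‖a i‖ ^ 2) + 0 * ∑ i, ‖b i - a i‖ ^ 2)) :=
    (Continuous.tendsto (by fun_prop) 0).mono_left nhdsWithin_le_nhds
  have hge := ge_of_tendsto hlim (Filter.eventually_of_mem (Ioc_mem_nhdsGT one_pos)
    fun t ht => hpos t ht.1 ht.2)
  linarith

end MinimalNorm

/-! ### Dilation of a channel through its Choi matrix. -/

section Stinespring

variable {B P : Type*} [Fintype B] [DecidableEq B] [Fintype P]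

/-- Stinespring dilation of a channel. -/
theorem IsChannel.exists_isIsometricExtension [DecidableEq P] {D : Superop B P} (hD : IsChannel D) :
    ∃ U : Matrix (P × (Fin (Fintype.card B) × P)) B ℂ, IsIsometricExtension U D := by
  set e := Fintype.equivFin B
  -- The unnormalized maximally entangled vector. Its image is the Choi matrix, and the columns of
  -- the root `Q` are the Kraus operators.
  set ω : Fin (Fintype.card B) × B → ℂ := fun p => if e p.2 = p.1 then 1 else 0 with hω
  have hpsd := hD.completelyPositive _ _ (Matrix.posSemidef_vecMulVec_self_star ω)
  obtain ⟨Q, hQ, hQQ⟩ := exists_posSemidef_mul_self_eq hpsd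
  have hblock : ∀ b b' : B,
      (Matrix.of fun a a' => Matrix.vecMulVec ω (star ω) (e b, a) (e b', a')) =
      Matrix.single b b' (1 : ℂ) := by
    intro b b'
    ext a a'
    simp only [Matrix.of_apply, Matrix.vecMulVec_apply, hω, Pi.star_apply, e.apply_eq_iff_eq,
      Matrix.single_apply, @eq_comm _ b a, @eq_comm _ b' a']
    by_cases h1 : a = b <;> by_cases h2 : a' = b' <;> simp [h1, h2]
  have hentry : ∀ b b' p p', D (Matrix.single b b' 1) p p' =
      ∑ f, Q (e b, p) f * star (Q (e b', p') f) := by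
    intro b b' p p'
    have h1 : (Q * Qᴴ) (e b, p) (e b', p') = D (Matrix.single b b' 1) p p' := by
      rw [hQ.1.eq, hQQ, ← hblock]
      rfl
    rw [← h1, Matrix.mul_apply]
    rfl
  refine ⟨Matrix.of fun p b => Q (e b, p.1) p.2, ?_, fun X => ?_⟩
  · ext b' b
    have ht := hD.tracePreserving (Matrix.single b b' 1)
    simp only [Matrix.trace, Matrix.diag, hentry] at ht
    rw [Matrix.mul_apply, Fintype.sum_prod_type]
    simp only [Matrix.conjTranspose_apply, Matrix.of_apply]
    calc _ = ∑ p, ∑ f, Q (e b, p) f * star (Q (e b', p) f) :=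
          Finset.sum_congr rfl fun p _ => Finset.sum_congr rfl fun f _ => mul_comm _ _
      _ = _ := by
          rw [ht]
          simp [Matrix.single_apply, Matrix.one_apply, ite_and]
  · ext p p'
    conv_lhs => rw [Matrix.matrix_eq_sum_single X]
    have hs : ∀ b b' : B, Matrix.single b b' (X b b') = X b b' • Matrix.single b b' (1 : ℂ) := by
      intro b b'
      rw [Matrix.smul_single, smul_eq_mul, mul_one]
    simp only [hs, map_sum, map_smul, Matrix.sum_apply, Matrix.smul_apply, hentry, smul_eq_mul,
      traceOutSnd, conjBy, LinearMap.coe_mk, AddHom.coe_mk, Matrix.of_apply, Matrix.mul_apply,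
      Matrix.conjTranspose_apply, Finset.sum_mul, Finset.mul_sum]
    rw [Finset.sum_comm]
    calc _ = ∑ b', ∑ f, ∑ b, X b b' * (Q (e b, p) f * star (Q (e b', p') f)) :=
          Finset.sum_congr rfl fun _ _ => Finset.sum_comm
      _ = ∑ f, ∑ b', ∑ b, X b b' * (Q (e b, p) f * star (Q (e b', p') f)) := Finset.sum_comm
      _ = _ := Finset.sum_congr rfl fun _ _ => Finset.sum_congr rfl fun _ _ =>
          Finset.sum_congr rfl fun _ _ => by ring

end Stinespring

/-! ### Distance of Kraus operators from multiples of the identity. -/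

section KrausDistance

variable {P R I : Type*} [Fintype P] [DecidableEq P] [Fintype R] [Fintype I]

theorem hsSq_sub {m n : Type*} [Fintype m] [Fintype n] (X Y : Matrix m n ℂ) :
    hsSq (X - Y) = hsSq X + hsSq Y - 2 * (Yᴴ * X).trace.re := by
  have h : (Xᴴ * Y).trace.re = (Yᴴ * X).trace.re := by
    rw [← Complex.conj_re (Yᴴ * X).trace, ← RCLike.star_def, ← Matrix.trace_conjTranspose,
      Matrix.conjTranspose_mul, Matrix.conjTranspose_conjTranspose]
  rw [hsSq_eq_re_trace, hsSq_eq_re_trace X, hsSq_eq_re_trace Y, Matrix.conjTranspose_sub,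
    Matrix.sub_mul, Matrix.mul_sub, Matrix.mul_sub]
  simp only [Matrix.trace_sub, Complex.sub_re]
  rw [h]
  ring

theorem hsSq_smul {m n : Type*} [Fintype m] [Fintype n] (c : ℂ) (X : Matrix m n ℂ) :
    hsSq (c • X) = ‖c‖ ^ 2 * hsSq X := by
  simp only [hsSq, Matrix.smul_apply, norm_smul, mul_pow, Finset.mul_sum]

theorem sum_hsSq_mul {Q : Type*} [Fintype Q] {M : I → Matrix Q P ℂ} (hM : ∑ i, (M i)ᴴ * M i = 1)
    (Φ : Matrix P R ℂ) : ∑ i, hsSq (M i * Φ) = hsSq Φ := by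
  have h : ((∑ i, hsSq (M i * Φ) : ℝ) : ℂ) = hsSq Φ := by
    push_cast
    simp only [← trace_conjTranspose_mul_self, Matrix.conjTranspose_mul]
    rw [← Matrix.trace_sum]
    simp only [Matrix.mul_assoc, ← Matrix.mul_sum]
    simp only [← Matrix.mul_assoc (M _)ᴴ, ← Matrix.sum_mul, hM, Matrix.one_mul]
  exact_mod_cast h

/-- The distance is governed by one real-linear functional of `Φ * Φᴴ`, so a lower bound on the
overlap over all states suffices. Both directions of the theorem use this. -/
theorem sum_hsSq_mul_sub_smul {M : I → Matrix P P ℂ} (hM : ∑ i, (M i)ᴴ * M i = 1) (w : I → ℂ)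
    (Φ : Matrix P R ℂ) :
    ∑ i, hsSq (M i * Φ - w i • Φ) = hsSq Φ * (1 + ∑ i, ‖w i‖ ^ 2) -
      2 * (∑ i, star (w i) * (M i * (Φ * Φᴴ)).trace).re := by
  have h : ∀ i, hsSq (M i * Φ - w i • Φ) = hsSq (M i * Φ) + ‖w i‖ ^ 2 * hsSq Φ -
      2 * (star (w i) * (M i * (Φ * Φᴴ)).trace).re := fun i => by
    rw [hsSq_sub, hsSq_smul, Matrix.conjTranspose_smul, Matrix.smul_mul, Matrix.trace_smul,
      smul_eq_mul, Matrix.trace_mul_comm Φᴴ, Matrix.mul_assoc]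
  simp only [h, Finset.sum_sub_distrib, Finset.sum_add_distrib, sum_hsSq_mul hM, ← Finset.sum_mul,
    ← Finset.mul_sum, Complex.re_sum]
  ring

end KrausDistance

/-! ### Polar decomposition, Powers–Størmer and Uhlmann. -/

section Fidelity

variable {m n q : Type*} [Fintype m] [DecidableEq m] [Fintype n] [DecidableEq n]
  [Fintype q] [DecidableEq q]

theorem IsContraction.transpose {W : Matrix m n ℂ} (hW : IsContraction W) :
    IsContraction Wᵀ := by
  have h : 1 - Wᵀᴴ * Wᵀ = (1 - Wᴴᴴ * Wᴴ)ᵀ := by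
    rw [Matrix.transpose_sub, Matrix.transpose_one, Matrix.transpose_mul,
      Matrix.conjTranspose_conjTranspose]
    rfl
  unfold IsContraction
  rw [h]
  exact Matrix.PosSemidef.transpose hW.conjTranspose

/-- A polar decomposition: some contraction `U` turns `M` into a positive square root of `M M†`. -/
theorem exists_isContraction_mul_conjTranspose_eq_sqrt (M : Matrix m n ℂ) :
    ∃ (a : Matrix m m ℂ) (U : Matrix m n ℂ),
      a.PosSemidef ∧ a * a = M * Mᴴ ∧ IsContraction U ∧ M * Uᴴ = a := by
  have hH := Matrix.posSemidef_self_mul_conjTranspose M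
  set T : Matrix m m ℂ := (hH.1.eigenvectorUnitary : Matrix m m ℂ) with hT
  set ev := hH.1.eigenvalues with hev
  have hnn : ∀ i, 0 ≤ ev i := hH.eigenvalues_nonneg
  have hTT : T * Tᴴ = 1 := Unitary.coe_mul_star_self hH.1.eigenvectorUnitary
  have hTT' : Tᴴ * T = 1 := Unitary.coe_star_mul_self hH.1.eigenvectorUnitary
  have hspec : M * Mᴴ = T * Matrix.diagonal (fun i => (ev i : ℂ)) * Tᴴ := by
    have h := hH.1.spectral_theorem
    rw [Unitary.conjStarAlgAut_apply] at h
    exact h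
  set D : Matrix m m ℂ := Matrix.diagonal fun i => (((√(ev i))⁻¹ : ℝ) : ℂ) with hD
  -- The pseudo-inverse of `√(M Mᴴ)`; zero eigenvalues are inverted to zero.
  set G : Matrix m m ℂ := T * D * Tᴴ with hG
  have hDh : Dᴴ = D := by
    rw [hD, Matrix.diagonal_conjTranspose]
    congr 1
    ext i
    simp
  have hGh : Gᴴ = G := by
    simp only [hG, Matrix.conjTranspose_mul, Matrix.conjTranspose_conjTranspose, hDh,
      Matrix.mul_assoc]
  have hcomb : ∀ X Y : Matrix m m ℂ, T * X * Tᴴ * (T * Y * Tᴴ) = T * (X * Y) * Tᴴ := by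
    intro X Y
    simp only [Matrix.mul_assoc]
    rw [← Matrix.mul_assoc Tᴴ, hTT', Matrix.one_mul]
  set a : Matrix m m ℂ := T * Matrix.diagonal (fun i => ((√(ev i) : ℝ) : ℂ)) * Tᴴ with ha
  refine ⟨a, G * M, ?_, ?_, ?_, ?_⟩
  · refine Matrix.PosSemidef.mul_mul_conjTranspose_same ?_ _
    rw [Matrix.posSemidef_diagonal_iff]
    exact fun i => Complex.zero_le_real.2 (Real.sqrt_nonneg _)
  · rw [ha, hcomb, hspec, Matrix.diagonal_mul_diagonal]
    congr 3
    ext i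
    rw [← Complex.ofReal_mul, Real.mul_self_sqrt (hnn i)]
  · have key : IsContraction (G * M)ᴴ := by
      unfold IsContraction
      have h1 : (G * M)ᴴᴴ * (G * M)ᴴ = G * (M * Mᴴ) * G := by
        rw [Matrix.conjTranspose_conjTranspose, Matrix.conjTranspose_mul, hGh]
        simp only [Matrix.mul_assoc]
      have h2 : (1 : Matrix m m ℂ) = T * 1 * Tᴴ := by rw [Matrix.mul_one, hTT]
      rw [h1, hspec, hG, hcomb, hcomb, h2, ← Matrix.sub_mul, ← Matrix.mul_sub]
      refine Matrix.PosSemidef.mul_mul_conjTranspose_same ?_ _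
      rw [hD, Matrix.diagonal_mul_diagonal, Matrix.diagonal_mul_diagonal, ← Matrix.diagonal_one,
        Matrix.diagonal_sub, Matrix.posSemidef_diagonal_iff]
      intro i
      have h1 : (√(ev i))⁻¹ * ev i * (√(ev i))⁻¹ ≤ 1 := by
        rcases (hnn i).eq_or_lt with h | h
        · simp [← h]
        · rw [mul_comm (√(ev i))⁻¹ (ev i), mul_assoc, ← mul_inv, Real.mul_self_sqrt (hnn i),
            mul_inv_cancel₀ h.ne']
      have h2 : (0 : ℂ) ≤ ((1 - (√(ev i))⁻¹ * ev i * (√(ev i))⁻¹ : ℝ) : ℂ) :=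
        Complex.zero_le_real.2 (by linarith)
      push_cast at h2 ⊢
      exact h2
    simpa using key.conjTranspose
  · rw [Matrix.conjTranspose_mul, hGh, ← Matrix.mul_assoc, hspec, hG, hcomb, ha, hD,
      Matrix.diagonal_mul_diagonal]
    congr 3
    ext i
    rw [← Complex.ofReal_mul, ← div_eq_mul_inv, Real.div_sqrt]

/-- The Powers–Størmer inequality. -/
theorem hsSq_sub_le_traceNorm {a b : Matrix m m ℂ} (ha : a.PosSemidef) (hb : b.PosSemidef) :
    hsSq (a - b) ≤ traceNorm (a * a - b * b) := by
  have hS : (a - b).IsHermitian := ha.1.sub hb.1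
  set T : Matrix m m ℂ := (hS.eigenvectorUnitary : Matrix m m ℂ) with hT
  set s := hS.eigenvalues with hs
  have hTT : T * Tᴴ = 1 := Unitary.coe_mul_star_self hS.eigenvectorUnitary
  have hTT' : Tᴴ * T = 1 := Unitary.coe_star_mul_self hS.eigenvectorUnitary
  have hspec : a - b = T * Matrix.diagonal (fun i => (s i : ℂ)) * Tᴴ := by
    have h := hS.spectral_theorem
    rw [Unitary.conjStarAlgAut_apply] at h
    exact h
  set D : Matrix m m ℂ := Matrix.diagonal fun i => (s i : ℂ) with hD
  -- The test contraction is the sign of `a - b`, with value `1` on its kernel.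
  set sg : m → ℝ := fun i => if 0 ≤ s i then 1 else -1 with hsg
  set F : Matrix m m ℂ := Matrix.diagonal fun i => (sg i : ℂ) with hF
  have hFF : Fᴴ * F = 1 := by
    rw [hF, Matrix.diagonal_conjTranspose, Matrix.diagonal_mul_diagonal, ← Matrix.diagonal_one]
    congr 1
    ext i
    by_cases h : 0 ≤ s i <;> simp [hsg, h]
  have hW : IsContraction (T * F * Tᴴ) := by
    refine isContraction_of_isometry ?_
    simp only [Matrix.conjTranspose_mul, Matrix.conjTranspose_conjTranspose, Matrix.mul_assoc]
    rw [← Matrix.mul_assoc Tᴴ T, hTT', Matrix.one_mul, ← Matrix.mul_assoc Fᴴ, hFF, Matrix.one_mul,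
      hTT]
  have ha' := ha.conjTranspose_mul_mul_same T
  have hb' := hb.conjTranspose_mul_mul_same T
  set b' := Tᴴ * b * T with hb'def
  have hab : Tᴴ * a * T = b' + D := by
    have h : a = b + T * D * Tᴴ := by rw [← hspec]; abel
    rw [h, Matrix.mul_add, Matrix.add_mul]
    congr 1
    simp only [Matrix.mul_assoc]
    rw [hTT', Matrix.mul_one, ← Matrix.mul_assoc, hTT', Matrix.one_mul]
  rw [hab] at ha'
  have hsq : ∀ x : Matrix m m ℂ, Tᴴ * (x * x) * T = (Tᴴ * x * T) * (Tᴴ * x * T) := by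
    intro x
    simp only [Matrix.mul_assoc]
    rw [← Matrix.mul_assoc T Tᴴ, hTT, Matrix.one_mul]
  have hexp : Tᴴ * (a * a - b * b) * T = b' * D + D * b' + D * D := by
    rw [Matrix.mul_sub, Matrix.sub_mul, hsq, hsq, hab, ← hb'def, Matrix.add_mul, Matrix.mul_add,
      Matrix.mul_add]
    abel
  have htr : (T * F * Tᴴ * (a * a - b * b)).trace = ∑ i, sg i * (2 * s i * b' i i + s i * s i) := by
    rw [Matrix.mul_assoc, Matrix.mul_assoc, Matrix.trace_mul_comm, Matrix.mul_assoc, hexp, hF,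
      Matrix.trace]
    refine Finset.sum_congr rfl fun i _ => ?_
    rw [Matrix.diag_apply, Matrix.diagonal_mul, Matrix.add_apply, Matrix.add_apply, hD,
      Matrix.mul_diagonal, Matrix.diagonal_mul, Matrix.diagonal_mul, Matrix.diagonal_apply_eq]
    ring
  have hb0 : ∀ i, b' i i = ((b' i i).re : ℂ) ∧ 0 ≤ (b' i i).re := fun i => by
    have h := hb'.diag_nonneg (i := i)
    rw [Complex.le_def] at h
    exact ⟨Complex.ext rfl (by simpa using h.2.symm), h.1⟩
  have ha0 : ∀ i, 0 ≤ (b' i i).re + s i := fun i => by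
    have h := ha'.diag_nonneg (i := i)
    rw [Complex.le_def] at h
    simpa [hD] using h.1
  have hhs : hsSq (a - b) = ∑ i, s i ^ 2 := by
    rw [hspec, Matrix.mul_assoc, hsSq_mul_of_isometry hTT', ← hsSq_conjTranspose,
      Matrix.conjTranspose_mul, Matrix.conjTranspose_conjTranspose, hsSq_mul_of_isometry hTT',
      hsSq_conjTranspose, hD, hsSq]
    refine Finset.sum_congr rfl fun i _ => ?_
    rw [Finset.sum_eq_single i (fun j _ hj => by rw [Matrix.diagonal_apply_ne _ hj.symm]; simp)
      (fun h => absurd (Finset.mem_univ i) h)]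
    simp
  refine le_trans ?_ ((Complex.re_le_norm _).trans (norm_trace_mul_le_traceNorm hW _))
  rw [htr, hhs, Complex.re_sum]
  refine Finset.sum_le_sum fun i _ => ?_
  have hre : ((sg i : ℂ) * (2 * s i * b' i i + s i * s i)).re =
      sg i * (2 * s i * (b' i i).re + s i * s i) := by
    rw [(hb0 i).1, ← Complex.ofReal_re (sg i * _)]
    push_cast
    rfl
  have h1 := (hb0 i).2
  have h2 := ha0 i
  rw [hre]
  -- Write `β` for the real part of `b' i i`. The claim is `s² ≤ sg (2 s β + s²)`: for `s ≥ 0` it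
  -- follows from `β ≥ 0`, and for `s < 0` from `β ≥ -s`, that is, from the positivity of `a`.
  by_cases h : 0 ≤ s i
  · simp only [hsg, h, if_true]
    nlinarith [mul_nonneg h h1]
  · simp only [hsg, h, if_false]
    nlinarith

theorem hsSq_eq_of_mul_self_eq {M : Matrix m n ℂ} {a : Matrix m m ℂ} (ha : a.PosSemidef)
    (haa : a * a = M * Mᴴ) : hsSq a = hsSq M := by
  rw [hsSq_eq_re_trace, ha.1.eq, haa, Matrix.trace_mul_comm, ← hsSq_eq_re_trace]

/-- Uhlmann's theorem combined with the Powers–Størmer inequality. -/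
theorem exists_isContraction_le_re_trace {M₁ : Matrix q n ℂ} {M₂ : Matrix q m ℂ} {ε : ℝ}
    (h₁ : hsSq M₁ = 1) (h₂ : hsSq M₂ = 1) (h : traceNorm (M₁ * M₁ᴴ - M₂ * M₂ᴴ) ≤ ε) :
    ∃ C : Matrix m n ℂ, IsContraction C ∧ 1 - ε / 2 ≤ (M₂ᴴ * M₁ * Cᵀ).trace.re := by
  obtain ⟨a, U, ha, haa, hU, hMU⟩ := exists_isContraction_mul_conjTranspose_eq_sqrt M₁
  obtain ⟨b, W, hb, hbb, hW, hMW⟩ := exists_isContraction_mul_conjTranspose_eq_sqrt M₂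
  -- The two polar contractions turn the overlap into `Tr (b a)`, whose real part is `1 - hsSq (a -
  -- b) / 2`. The transpose appears because a decoder acts on the column index from the right.
  refine ⟨(Uᴴ * W)ᵀ, (hU.conjTranspose.mul hW).transpose, ?_⟩
  have h1 := hsSq_sub_le_traceNorm ha hb
  rw [haa, hbb, hsSq_sub] at h1
  rw [hsSq_eq_of_mul_self_eq ha haa, hsSq_eq_of_mul_self_eq hb hbb, h₁, h₂] at h1
  have h2 : (M₂ᴴ * M₁ * (Uᴴ * W)ᵀᵀ).trace = (bᴴ * a).trace := by
    rw [Matrix.transpose_transpose, ← hMU, ← hMW, Matrix.conjTranspose_mul,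
      Matrix.conjTranspose_conjTranspose, Matrix.mul_assoc W, Matrix.trace_mul_comm W]
    simp only [Matrix.mul_assoc]
  rw [h2]
  linarith

end Fidelity

/-! ### Coordinates on a subspace. -/

section Inclusion

variable {A : Type*} [Fintype A] (S : Submodule ℂ (EuclideanSpace ℂ A))

theorem inclusionMatrix_isometry :
    (inclusionMatrix S)ᴴ * inclusionMatrix S = 1 := by
  ext i j
  have h := orthonormal_iff_ite.1 (stdOrthonormalBasis ℂ S).orthonormal i j
  rw [Submodule.coe_inner, EuclideanSpace.inner_eq_star_dotProduct] at h
  rw [Matrix.one_apply, ← h, Matrix.mul_apply, dotProduct]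
  exact Finset.sum_congr rfl fun a _ => mul_comm _ _

theorem inclusionMatrix_mul_conjTranspose_mul {R : Type*} [Fintype R] {Φ : Matrix A R ℂ}
    (hΦ : ∀ r, WithLp.toLp 2 (fun a => Φ a r) ∈ S) :
    inclusionMatrix S * ((inclusionMatrix S)ᴴ * Φ) = Φ := by
  ext a r
  have h := congrArg (fun x : S => (x : EuclideanSpace ℂ A) a)
    ((stdOrthonormalBasis ℂ S).sum_repr' ⟨_, hΦ r⟩)
  simp only [Submodule.coe_sum, Submodule.coe_smul, Submodule.coe_inner,
    EuclideanSpace.inner_eq_star_dotProduct, WithLp.ofLp_sum, WithLp.ofLp_smul, Finset.sum_apply,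
    Pi.smul_apply, smul_eq_mul] at h
  rw [← h, Matrix.mul_apply]
  refine Finset.sum_congr rfl fun i _ => ?_
  rw [mul_comm, Matrix.mul_apply, dotProduct]
  congr 1
  exact Finset.sum_congr rfl fun a _ => mul_comm _ _

end Inclusion

/-- The block of `V : ℂ^A → ℂ^B ⊗ ℂ^E` at the basis vector `e` of `ℂ^E`. -/
def envBlock {A B E : Type*} (V : Matrix (B × E) A ℂ) (e : E) : Matrix B A ℂ :=
  V.submatrix (fun b => (b, e)) id

section Blocks

variable {A B E I J P : Type*} [Fintype A] [Fintype B] [Fintype E] [Fintype I]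

theorem sum_envBlock_conjTranspose_mul (V W : Matrix (B × E) A ℂ) :
    ∑ e, (envBlock V e)ᴴ * envBlock W e = Vᴴ * W := by
  ext a a'
  simp only [Matrix.sum_apply, Matrix.mul_apply, Fintype.sum_prod_type, envBlock,
    Matrix.conjTranspose_apply, Matrix.submatrix_apply, id]
  exact Finset.sum_comm

theorem envBlock_mul (V : Matrix (B × E) A ℂ) (X : Matrix A J ℂ) (e : E) :
    envBlock (V * X) e = envBlock V e * X := rfl

theorem IsIsometricExtension.eq_krausMap [DecidableEq A] {V : Matrix (B × E) A ℂ} {N : Superop A B}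
    (hV : IsIsometricExtension V N) : N = krausMap (envBlock V) := by
  refine LinearMap.ext fun X => ?_
  rw [hV.eq_traceOut, krausMap_apply]
  ext b b'
  simp only [traceOutSnd, conjBy, LinearMap.coe_mk, AddHom.coe_mk, Matrix.of_apply,
    Matrix.sum_apply]
  rfl

theorem krausMap_comp [Fintype P] (K : I → Matrix P B ℂ) (M : E → Matrix B A ℂ) :
    krausMap K ∘ₗ krausMap M = krausMap fun p : I × E => K p.1 * M p.2 := by
  refine LinearMap.ext fun X => ?_
  rw [LinearMap.comp_apply, krausMap_apply, krausMap_apply, krausMap_apply, Fintype.sum_prod_type]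
  refine Finset.sum_congr rfl fun i _ => ?_
  rw [Matrix.mul_sum, Matrix.sum_mul]
  refine Finset.sum_congr rfl fun e _ => ?_
  simp only [Matrix.conjTranspose_mul, Matrix.mul_assoc]

theorem krausMap_comp_conjBy [Fintype J] (M : I → Matrix B A ℂ) (K : Matrix A J ℂ) :
    krausMap M ∘ₗ conjBy K = krausMap fun i => M i * K := by
  refine LinearMap.ext fun X => ?_
  rw [LinearMap.comp_apply, krausMap_apply, krausMap_apply]
  refine Finset.sum_congr rfl fun i _ => ?_
  simp only [conjBy, LinearMap.coe_mk, AddHom.coe_mk, Matrix.conjTranspose_mul, Matrix.mul_assoc]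

theorem sum_conjTranspose_mul_comp [DecidableEq A] [DecidableEq B] [Fintype P]
    {K : I → Matrix P B ℂ} {M : E → Matrix B A ℂ}
    (hK : ∑ i, (K i)ᴴ * K i = 1) (hM : ∑ e, (M e)ᴴ * M e = 1) :
    ∑ p : I × E, (K p.1 * M p.2)ᴴ * (K p.1 * M p.2) = 1 := by
  rw [Fintype.sum_prod_type, Finset.sum_comm, ← hM]
  refine Finset.sum_congr rfl fun e _ => ?_
  calc ∑ i, (K i * M e)ᴴ * (K i * M e) = ∑ i, (M e)ᴴ * ((K i)ᴴ * K i) * M e :=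
        Finset.sum_congr rfl fun i _ => by
          simp only [Matrix.conjTranspose_mul, Matrix.mul_assoc]
    _ = (M e)ᴴ * M e := by rw [← Matrix.sum_mul, ← Matrix.mul_sum, hK, Matrix.mul_one]

end Blocks

/-! ### Channels close to the identity. -/

section KrausClose

variable {P I R : Type*} [Fintype P] [DecidableEq P] [Fintype I] [Fintype R] [DecidableEq R]

theorem krausStack_sub_smul_one (M : I → Matrix P P ℂ) (w : I → ℂ) (Φ : Matrix P R ℂ) :
    hsSq (krausStack M Φ - krausStack (fun i => w i • (1 : Matrix P P ℂ)) Φ) =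
      ∑ i, hsSq (M i * Φ - w i • Φ) := by
  have h : krausStack M Φ - krausStack (fun i => w i • (1 : Matrix P P ℂ)) Φ =
      krausStack (fun i => M i - w i • (1 : Matrix P P ℂ)) Φ := by
    ext p i
    simp [krausStack, Matrix.sub_mul]
  rw [h, hsSq_krausStack]
  refine Finset.sum_congr rfl fun i _ => ?_
  rw [Matrix.sub_mul, Matrix.smul_mul, Matrix.one_mul]

theorem mul_hsSq_le_of_forall_isDensity {Z : Matrix P P ℂ} {c : ℝ}
    (h : ∀ ρ, IsDensity ρ → c ≤ (Z * ρ).trace.re) (Φ : Matrix P R ℂ) :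
    c * hsSq Φ ≤ (Z * (Φ * Φᴴ)).trace.re := by
  rcases (hsSq_nonneg Φ).eq_or_lt with h0 | h0
  · have hz : Φ = 0 := by
      have := Complex.ofReal_eq_zero.2 h0.symm
      rw [← trace_conjTranspose_mul_self, Matrix.trace_conjTranspose_mul_self_eq_zero_iff] at this
      exact this
    simp [hz, hsSq_zero]
  · have hd : IsDensity (((hsSq Φ)⁻¹ : ℂ) • (Φ * Φᴴ)) := by
      refine ⟨(Matrix.posSemidef_self_mul_conjTranspose Φ).smul ?_, ?_⟩
      · rw [← Complex.ofReal_inv]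
        exact Complex.zero_le_real.2 (inv_nonneg.2 h0.le)
      · rw [Matrix.trace_smul, Matrix.trace_mul_comm, trace_conjTranspose_mul_self, smul_eq_mul,
          inv_mul_cancel₀ (by exact_mod_cast h0.ne')]
    have := h _ hd
    rw [Matrix.mul_smul, Matrix.trace_smul, ← Complex.ofReal_inv, smul_eq_mul,
      Complex.re_ofReal_mul, inv_mul_eq_div, le_div_iff₀ h0] at this
    exact this

/-- Kraus operators that are close to multiples of the identity define a channel that is close to
the identity channel. -/
theorem diamondNorm_krausMap_sub_id_le {M : I → Matrix P P ℂ} (hM : ∑ i, (M i)ᴴ * M i = 1)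
    {w : I → ℂ} (hw : ∑ i, ‖w i‖ ^ 2 = 1) {ε : ℝ≥0}
    (h : ∀ ρ, IsDensity ρ → (1 - ε / 2 : ℝ) ≤ ((∑ i, star (w i) • M i) * ρ).trace.re) :
    diamondNorm (krausMap M - LinearMap.id) ≤ (2 * NNReal.sqrt ε : ℝ≥0) := by
  refine iSup_le fun k => kDiamondNorm_le_of_ketBra fun Φ Ψ => ?_
  -- Because `∑ i, ‖w i‖² = 1`, the identity channel has the Kraus operators `w i • 1`, so the two
  -- channels can be compared operator by operator.
  set T : I → Matrix P P ℂ := fun i => w i • 1 with hT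
  have hTT : ∑ i, (T i)ᴴ * T i = 1 := by
    have h1 : ∀ i, (T i)ᴴ * T i = ((‖w i‖ ^ 2 : ℝ) : ℂ) • (1 : Matrix P P ℂ) := fun i => by
      simp only [hT, Matrix.conjTranspose_smul, Matrix.conjTranspose_one, Matrix.smul_mul,
        Matrix.mul_smul, Matrix.one_mul, smul_smul]
      congr 1
      push_cast
      exact Complex.mul_conj' (w i)
    simp only [h1]
    rw [← Finset.sum_smul, ← Complex.ofReal_sum, hw, Complex.ofReal_one, one_smul]
  have hid : (LinearMap.id : Superop P P) = krausMap T := by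
    refine LinearMap.ext fun X => ?_
    have h1 : ∀ i, T i * X * (T i)ᴴ = (T i)ᴴ * T i * X := fun i => by
      simp only [hT, Matrix.conjTranspose_smul, Matrix.conjTranspose_one, Matrix.smul_mul,
        Matrix.mul_smul, Matrix.one_mul, Matrix.mul_one, smul_comm (w i)]
    rw [krausMap_apply]
    simp only [h1]
    rw [← Matrix.sum_mul, hTT, Matrix.one_mul, LinearMap.id_apply]
  -- For a normalized `w` the squared distance is `2 hsSq Θ` minus twice the overlap, hence at most
  -- `ε hsSq Θ`.
  have hdist : ∀ Θ : Matrix P (Fin k) ℂ,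
      √(hsSq (krausStack M Θ - krausStack T Θ)) ≤ √ε * √(hsSq Θ) := fun Θ => by
    rw [← Real.sqrt_mul ε.coe_nonneg, krausStack_sub_smul_one, sum_hsSq_mul_sub_smul hM, hw]
    refine Real.sqrt_le_sqrt ?_
    have h1 := mul_hsSq_le_of_forall_isDensity h Θ
    rw [Matrix.sum_mul, Matrix.trace_sum] at h1
    simp only [Matrix.smul_mul, Matrix.trace_smul, smul_eq_mul] at h1
    linarith
  rw [idTensor_sub_apply, hid, idTensor_krausMap_ketBra, idTensor_krausMap_ketBra]
  refine (traceNorm_mul_conjTranspose_sub_le _ _ _ _).trans ?_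
  rw [hsSq_krausStack, hsSq_krausStack, sum_hsSq_mul hM, sum_hsSq_mul hTT]
  calc _ ≤ √ε * √(hsSq Φ) * √(hsSq Ψ) + √(hsSq Φ) * (√ε * √(hsSq Ψ)) :=
        add_le_add (mul_le_mul_of_nonneg_right (hdist Φ) (Real.sqrt_nonneg _))
          (mul_le_mul_of_nonneg_left (hdist Ψ) (Real.sqrt_nonneg _))
    _ = _ := by
        push_cast
        ring

end KrausClose

/-! ### The overlap achieved by a decoder. -/

section Decoupling

variable {A B E : Type*} [Fintype A] [DecidableEq A] [Fintype B] [DecidableEq B]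
  [Fintype E] [DecidableEq E]

/-- A purification of the output of the complementary channel. -/
theorem exists_complementary_eq_mul_conjTranspose {V : Matrix (B × E) A ℂ} (hV : Vᴴ * V = 1)
    {ρ : Matrix A A ℂ} (hρ : IsDensity ρ) :
    ∃ L : Matrix E (B × A) ℂ, hsSq L = 1 ∧ complementary V ρ = L * Lᴴ := by
  obtain ⟨K, hK, rfl⟩ := hρ.exists_eq_mul_conjTranspose
  refine ⟨Matrix.of fun e p => (V * K) (p.1, e) p.2, ?_, ?_⟩
  · rw [← hK, ← hsSq_mul_of_isometry hV K]
    simp only [hsSq, Matrix.of_apply, Fintype.sum_prod_type]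
    exact Finset.sum_comm
  · ext e e'
    have h : V * (K * Kᴴ) * Vᴴ = (V * K) * (V * K)ᴴ := by
      simp only [Matrix.conjTranspose_mul, Matrix.mul_assoc]
    simp only [complementary, traceOutFst, conjBy, LinearMap.comp_apply, LinearMap.coe_mk,
      AddHom.coe_mk, Matrix.of_apply, h, Matrix.mul_apply (M := V * K), Matrix.mul_apply (M :=
      Matrix.of _), Fintype.sum_prod_type, Matrix.conjTranspose_apply]

/-- Compose a decoder `C` with `V`, projecting the environment onto the purification `L`. -/
def decoderOverlap {P F : Type*} [Fintype F] (V : Matrix (B × E) P ℂ) (L : Matrix E F ℂ) :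
    Matrix (P × F) B ℂ →ₗ[ℂ] Matrix P P ℂ where
  toFun C := ∑ f, ∑ e, star (L e f) • (envBlock C f * envBlock V e)
  map_add' C C' := by
    have h : ∀ f, envBlock (C + C') f = envBlock C f + envBlock C' f := fun f => rfl
    simp only [h, Matrix.add_mul, smul_add, Finset.sum_add_distrib]
  map_smul' c C := by
    have h : ∀ f, envBlock (c • C) f = c • envBlock C f := fun f => rfl
    simp only [h, Matrix.smul_mul, Finset.smul_sum, RingHom.id_apply, smul_comm c]

/-- Rewrites Uhlmann's overlap so that the purification `K` enters only through the state `K * Kᴴ`,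
linearly; this is the form that the minimax theorem needs. -/
theorem trace_decoderOverlap {P F R : Type*} [Fintype P] [DecidableEq P] [Fintype F] [Fintype R]
    (V : Matrix (B × E) P ℂ) (L : Matrix E F ℂ) (C : Matrix (P × F) B ℂ) (K : Matrix P R ℂ) :
    ((Matrix.kroneckerMap (· * ·) Kᵀ L)ᴴ * toEnv V K * Cᵀ).trace =
      (decoderOverlap V L C * (K * Kᴴ)).trace := by
  have hR : (decoderOverlap V L C * (K * Kᴴ)).trace =
      ∑ p, ∑ r, ∑ f, ∑ e, ∑ b,
        star (L e f) * (C (p, f) b * (V * K) (b, e) r) * star (K p r) := by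
    rw [← Matrix.mul_assoc, Matrix.trace]
    refine Finset.sum_congr rfl fun p _ => ?_
    rw [Matrix.diag_apply, Matrix.mul_apply]
    refine Finset.sum_congr rfl fun r _ => ?_
    simp only [decoderOverlap, LinearMap.coe_mk, AddHom.coe_mk, Matrix.sum_mul, Matrix.sum_apply,
      Matrix.smul_mul, Matrix.smul_apply, Matrix.mul_assoc, ← envBlock_mul V, smul_eq_mul,
      Matrix.conjTranspose_apply]
    rw [Finset.sum_mul]
    refine Finset.sum_congr rfl fun f _ => ?_
    rw [Finset.sum_mul]
    refine Finset.sum_congr rfl fun e _ => ?_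
    rw [Matrix.mul_apply, Finset.mul_sum, Finset.sum_mul]
    rfl
  have hL : ((Matrix.kroneckerMap (· * ·) Kᵀ L)ᴴ * toEnv V K * Cᵀ).trace =
      ∑ p, ∑ f, ∑ b, ∑ r, ∑ e,
        star (L e f) * (C (p, f) b * (V * K) (b, e) r) * star (K p r) := by
    rw [Matrix.trace, Fintype.sum_prod_type]
    refine Finset.sum_congr rfl fun p _ => Finset.sum_congr rfl fun f _ => ?_
    rw [Matrix.diag_apply, Matrix.mul_apply]
    refine Finset.sum_congr rfl fun b _ => ?_
    rw [Matrix.mul_apply, Fintype.sum_prod_type, Finset.sum_mul]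
    refine Finset.sum_congr rfl fun r _ => ?_
    rw [Finset.sum_mul]
    refine Finset.sum_congr rfl fun e _ => ?_
    simp only [Matrix.conjTranspose_apply, Matrix.kroneckerMap_apply, Matrix.transpose_apply, toEnv,
      Matrix.of_apply, star_mul']
    ring
  rw [hL, hR]
  refine Finset.sum_congr rfl fun p _ => ?_
  calc _ = ∑ f, ∑ r, ∑ b, ∑ e, star (L e f) * (C (p, f) b * (V * K) (b, e) r) * star (K p r) :=
        Finset.sum_congr rfl fun _ _ => Finset.sum_comm
    _ = ∑ r, ∑ f, ∑ b, ∑ e, star (L e f) * (C (p, f) b * (V * K) (b, e) r) * star (K p r) :=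
        Finset.sum_comm
    _ = _ := Finset.sum_congr rfl fun _ _ => Finset.sum_congr rfl fun _ _ => Finset.sum_comm

end Decoupling

/-! ### Forgetfulness implies decodability. -/

section DecodingOfDecoupling

variable {A B E : Type*} [Fintype A] [DecidableEq A] [Fintype B] [DecidableEq B]
  [Fintype E] [DecidableEq E]

theorem transpose_mul_transpose_conjTranspose {m R : Type*} [Fintype m] (Φ Ψ : Matrix m R ℂ) :
    Φᵀ * Ψᵀᴴ = (Ψᴴ * Φ)ᵀ := by
  rw [Matrix.transpose_mul]
  rfl

theorem exists_coisometry {d k : ℕ} (h : d ≤ k) : ∃ T : Matrix (Fin d) (Fin k) ℂ, T * Tᴴ = 1 := by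
  refine ⟨(1 : Matrix (Fin k) (Fin k) ℂ).submatrix (Fin.castLE h) id, ?_⟩
  rw [Matrix.conjTranspose_submatrix, ← Matrix.submatrix_mul _ _ _ _ _ Function.bijective_id,
    Matrix.conjTranspose_one, Matrix.one_mul, Matrix.submatrix_one _ (Fin.castLE_injective h)]

/-- For every state on a subspace of dimension at most `k`, forgetfulness of the complementary
channel provides a decoder that works on that state. -/
theorem exists_isContraction_le_decoderOverlap {V : Matrix (B × E) A ℂ} (hV : Vᴴ * V = 1) {k d : ℕ}
    {ε : ℝ≥0} {F : Type*} [Fintype F] [DecidableEq F] {L : Matrix E F ℂ} (hL : hsSq L = 1)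
    (hε : kDiamondNorm k (complementary V - constantTo (L * Lᴴ)) ≤ ε)
    {J : Matrix A (Fin d) ℂ} (hJ : Jᴴ * J = 1) (hd : d ≤ k) {τ : Matrix (Fin d) (Fin d) ℂ}
    (hτ : IsDensity τ) :
    ∃ C : Matrix (Fin d × F) B ℂ, IsContraction C ∧
      (1 - ε / 2 : ℝ) ≤ (decoderOverlap (V * J) L C * τ).trace.re := by
  obtain ⟨K₀, hK₀, rfl⟩ := hτ.exists_eq_mul_conjTranspose
  -- Enlarges the reference from dimension `d` to `k`, where the norm hypothesis applies, without
  -- changing the state.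
  obtain ⟨T, hT⟩ := exists_coisometry hd
  set K := K₀ * T with hK
  have hKK : K * Kᴴ = K₀ * K₀ᴴ := by
    rw [hK, Matrix.conjTranspose_mul, Matrix.mul_assoc, ← Matrix.mul_assoc T, hT, Matrix.one_mul]
  have hK1 : hsSq K = 1 := by
    rw [← hK₀, hsSq_eq_re_trace, hsSq_eq_re_trace, Matrix.trace_mul_comm, hKK,
      Matrix.trace_mul_comm]
  have hΦ : hsSq (J * K) = 1 := by rw [hsSq_mul_of_isometry hJ, hK1]
  have hnear := traceNorm_idTensor_ketBra_le_of_kDiamondNorm_le hε hΦ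
  have hkron : Matrix.kroneckerMap (· * ·) ((J * K)ᵀ * (J * K)ᵀᴴ) (L * Lᴴ) =
      Matrix.kroneckerMap (· * ·) Kᵀ L * (Matrix.kroneckerMap (· * ·) Kᵀ L)ᴴ := by
    have h1 : (J * K)ᵀ * (J * K)ᵀᴴ = Kᵀ * Kᵀᴴ := by
      rw [transpose_mul_transpose_conjTranspose, transpose_mul_transpose_conjTranspose,
        Matrix.conjTranspose_mul, Matrix.mul_assoc, ← Matrix.mul_assoc Jᴴ, hJ, Matrix.one_mul]
    rw [h1, Matrix.mul_kronecker_mul]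
    congr 1
    exact (Matrix.conjTranspose_kronecker _ _).symm
  rw [idTensor_sub_apply, idTensor_complementary_ketBra, idTensor_constantTo_ketBra, hkron] at hnear
  have hM₁ : hsSq (toEnv V (J * K)) = 1 := by rw [hsSq_toEnv hV, hΦ]
  have hM₂ : hsSq (Matrix.kroneckerMap (· * ·) Kᵀ L) = 1 := by
    have : hsSq (Matrix.kroneckerMap (· * ·) Kᵀ L) = hsSq Kᵀ * hsSq L := by
      simp only [hsSq, Matrix.kroneckerMap_apply, Fintype.sum_prod_type, norm_mul, mul_pow]
      rw [Finset.sum_mul_sum]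
      refine Finset.sum_congr rfl fun r _ => Finset.sum_congr rfl fun e _ => ?_
      rw [Finset.sum_mul_sum]
    rw [this, hsSq_transpose, hK1, hL, one_mul]
  obtain ⟨C, hC, hCe⟩ := exists_isContraction_le_re_trace hM₁ hM₂ hnear
  refine ⟨C, hC, ?_⟩
  have htoEnv : toEnv V (J * K) = toEnv (V * J) K := by
    simp only [toEnv, Matrix.mul_assoc]
  rw [htoEnv, trace_decoderOverlap, hKK] at hCe
  exact hCe

/-- The Kraus operators of the channel that applies the contraction `C` and discards the second
factor, completed by an arbitrary preparation. -/
noncomputable def decoderKraus {P F : Type*} [DecidableEq P] (C : Matrix (P × F) B ℂ)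
    (Y : Matrix B B ℂ) (p₀ : P) : F ⊕ B → Matrix P B ℂ :=
  Sum.elim (envBlock C) fun b => Matrix.of fun p b' => if p = p₀ then Y b b' else 0

theorem sum_decoderKraus {P F : Type*} [Fintype P] [DecidableEq P] [Fintype F]
    {C : Matrix (P × F) B ℂ} {Y : Matrix B B ℂ} (hY : Yᴴ * Y = 1 - Cᴴ * C) (p₀ : P) :
    ∑ i, (decoderKraus C Y p₀ i)ᴴ * decoderKraus C Y p₀ i = 1 := by
  have h : ∑ b, (decoderKraus C Y p₀ (Sum.inr b))ᴴ * decoderKraus C Y p₀ (Sum.inr b) = Yᴴ * Y := by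
    ext b b'
    simp [decoderKraus, Matrix.sum_apply, Matrix.mul_apply, apply_ite star]
  rw [Fintype.sum_sum_type, h, hY]
  change ∑ f, (envBlock C f)ᴴ * envBlock C f + _ = 1
  rw [sum_envBlock_conjTranspose_mul]
  abel

/-- If the complementary channel is `ε`-forgetful, subspaces can be decoded. -/
theorem decodableWithError_of_kDiamondNorm_le {N : Superop A B} {V : Matrix (B × E) A ℂ}
    (hV : IsIsometricExtension V N) {k : ℕ} {ε : ℝ≥0} {ρ : Matrix A A ℂ} (hρ : IsDensity ρ)
    (hε : kDiamondNorm k (complementary V - constantTo (complementary V ρ)) ≤ ε)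
    {S : Submodule ℂ (EuclideanSpace ℂ A)} (hS : S ≠ ⊥) (hd : Module.finrank ℂ S ≤ k) :
    DecodableWithError N S (2 * NNReal.sqrt ε) := by
  obtain ⟨L, hL, hσ⟩ := exists_complementary_eq_mul_conjTranspose hV.isometry hρ
  rw [hσ] at hε
  have hpos : 0 < Module.finrank ℂ S := Module.finrank_pos_iff.2
    ((Submodule.nontrivial_iff_ne_bot).2 hS)
  have : Nonempty (Fin (Module.finrank ℂ S)) := ⟨⟨0, hpos⟩⟩
  set J := inclusionMatrix S with hJdef
  have hJ : Jᴴ * J = 1 := inclusionMatrix_isometry S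
  -- Minimax exchanges the quantifiers: one contraction for all states of the subspace.
  obtain ⟨C, hC, hCe⟩ := exists_isContraction_forall_isDensity (decoderOverlap (V * J) L)
    fun τ hτ => exists_isContraction_le_decoderOverlap hV.isometry hL hε hJ hd hτ
  obtain ⟨Y, hY, hYY⟩ := exists_posSemidef_mul_self_eq hC
  have hY' : Yᴴ * Y = 1 - Cᴴ * C := by rw [hY.1.eq, hYY]
  set K := decoderKraus C Y ⟨0, hpos⟩ with hK
  have hKK : ∑ i, (K i)ᴴ * K i = 1 := sum_decoderKraus hY' _
  refine ⟨krausMap K, isChannel_krausMap hKK, ?_⟩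
  have hcomp : krausMap K ∘ₗ restrictTo N S =
      krausMap fun p : (_ ⊕ B) × E => K p.1 * envBlock (V * J) p.2 := by
    rw [restrictTo, hV.eq_krausMap, krausMap_comp_conjBy, krausMap_comp]
    rfl
  have hVJ : ∑ e, (envBlock (V * J) e)ᴴ * envBlock (V * J) e = 1 := by
    rw [sum_envBlock_conjTranspose_mul, Matrix.conjTranspose_mul, Matrix.mul_assoc,
      ← Matrix.mul_assoc Vᴴ, hV.isometry, Matrix.one_mul, hJ]
  rw [hcomp]
  -- The weights are the entries of the purification `L`, of total weight `hsSq L = 1`. The Kraus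
  -- operators that complete `C` to a channel get weight zero.
  refine diamondNorm_krausMap_sub_id_le (sum_conjTranspose_mul_comp hKK hVJ)
    (w := fun p => Sum.elim (fun f => L p.2 f) (fun _ => 0) p.1) ?_ fun τ hτ => ?_
  · rw [Fintype.sum_prod_type, Fintype.sum_sum_type, ← hL, hsSq, Finset.sum_comm]
    simp
  · have hZ : (∑ p : ((B × A) ⊕ B) × E, star (Sum.elim (fun f => L p.2 f) (fun _ => (0 : ℂ)) p.1) •
        (K p.1 * envBlock (V * J) p.2)) = decoderOverlap (V * J) L C := by
      rw [Fintype.sum_prod_type, Fintype.sum_sum_type]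
      simp only [Sum.elim_inr, star_zero, zero_smul, Finset.sum_const_zero, add_zero]
      rfl
    rw [hZ]
    exact hCe τ hτ

end DecodingOfDecoupling

/-! ### Partial traces. -/

section PartialTrace

variable {R E Q A B : Type*} [Fintype R] [DecidableEq R] [Fintype E] [DecidableEq E] [Fintype Q]

/-- By duality: testing the marginal against `W` is testing `X` against the contraction `1 ⊗ W`. -/
theorem traceNorm_traceOutFst_le (X : Matrix (R × E) (R × E) ℂ) :
    traceNorm (traceOutFst X) ≤ traceNorm X := by
  refine traceNorm_le_of_forall fun W hW => ?_
  have hc : IsContraction (Matrix.kroneckerMap (· * ·) (1 : Matrix R R ℂ) W) := by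
    have h : 1 - (Matrix.kroneckerMap (· * ·) (1 : Matrix R R ℂ) W)ᴴ *
        Matrix.kroneckerMap (· * ·) (1 : Matrix R R ℂ) W =
        Matrix.kroneckerMap (· * ·) (1 : Matrix R R ℂ) (1 - Wᴴ * W) := by
      rw [Matrix.conjTranspose_kronecker, ← Matrix.mul_kronecker_mul, Matrix.conjTranspose_one,
        Matrix.one_mul]
      ext p q
      rcases p with ⟨r, e⟩
      rcases q with ⟨r', e'⟩
      by_cases h : r = r'
      · simp [h, Matrix.one_apply]
      · simp [h]
    unfold IsContraction
    rw [h]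
    exact Matrix.PosSemidef.one.kronecker hW
  have htr : (W * traceOutFst X).trace =
      (Matrix.kroneckerMap (· * ·) (1 : Matrix R R ℂ) W * X).trace := by
    simp only [Matrix.trace, Matrix.diag_apply, Matrix.mul_apply, traceOutFst, LinearMap.coe_mk,
      AddHom.coe_mk, Matrix.of_apply, Fintype.sum_prod_type, Matrix.kroneckerMap_apply,
      Matrix.one_apply, ite_mul, one_mul, zero_mul, Finset.mul_sum]
    rw [Finset.sum_comm]
    calc _ = ∑ e', ∑ r, ∑ e, W e e' * X (r, e') (r, e) :=
          Finset.sum_congr rfl fun _ _ => Finset.sum_comm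
      _ = ∑ r, ∑ e', ∑ e, W e e' * X (r, e') (r, e) := Finset.sum_comm
      _ = ∑ r, ∑ e, ∑ e', W e e' * X (r, e') (r, e) :=
          Finset.sum_congr rfl fun _ _ => Finset.sum_comm
      _ = _ := Finset.sum_congr rfl fun r _ => Finset.sum_congr rfl fun e _ => by
          rw [Finset.sum_eq_single r (fun r' _ hr' => by simp [hr'.symm]) (by simp)]
          simp
  rw [htr]
  exact norm_trace_mul_le_traceNorm hc X

theorem traceOutFst_idTensor_ketBra [Fintype A] (Γ : Superop A E) (Φ Ψ : Matrix A R ℂ) :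
    traceOutFst (idTensor R Γ (ketBra Φ Ψ)) = Γ (Φ * Ψᴴ) := by
  have h : Φ * Ψᴴ = ∑ r, Matrix.vecMulVec (fun a => Φ a r) (star fun a => Ψ a r) := by
    ext a a'
    simp [Matrix.mul_apply, Matrix.sum_apply, Matrix.vecMulVec_apply]
  ext e e'
  rw [h, map_sum, Matrix.sum_apply]
  simp only [traceOutFst, LinearMap.coe_mk, AddHom.coe_mk, Matrix.of_apply, idTensor_ketBra_apply]

end PartialTrace

/-! ### Joint vectors of decoder output, ancilla and environment. -/

section EnvStack

variable {R P F E : Type*} [Fintype R] [DecidableEq R] [Fintype P] [DecidableEq P] [Fintype F]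
  [Fintype E] [DecidableEq E]

/-- The vector `(1 ⊗ M) φ` with `M = ∑ f e, M (f, e) ⊗ |f⟩ ⊗ |e⟩`, as a matrix from
`ℂ^P ⊗ ℂ^F` to `ℂ^R ⊗ ℂ^E`. -/
def envStack (M : F × E → Matrix P P ℂ) (Φ : Matrix P R ℂ) : Matrix (R × E) (P × F) ℂ :=
  Matrix.of fun q t => (M (t.2, q.2) * Φ) t.1 q.1

theorem hsSq_envStack (M : F × E → Matrix P P ℂ) (Φ : Matrix P R ℂ) :
    hsSq (envStack M Φ) = ∑ i, hsSq (M i * Φ) := by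
  simp only [hsSq, envStack, Matrix.of_apply, Fintype.sum_prod_type]
  calc ∑ r, ∑ e, ∑ p, ∑ f, ‖(M (f, e) * Φ) p r‖ ^ 2
      = ∑ r, ∑ e, ∑ f, ∑ p, ‖(M (f, e) * Φ) p r‖ ^ 2 :=
        Finset.sum_congr rfl fun _ _ => Finset.sum_congr rfl fun _ _ => Finset.sum_comm
    _ = ∑ r, ∑ f, ∑ e, ∑ p, ‖(M (f, e) * Φ) p r‖ ^ 2 :=
        Finset.sum_congr rfl fun _ _ => Finset.sum_comm
    _ = ∑ f, ∑ r, ∑ e, ∑ p, ‖(M (f, e) * Φ) p r‖ ^ 2 := Finset.sum_comm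
    _ = ∑ f, ∑ e, ∑ r, ∑ p, ‖(M (f, e) * Φ) p r‖ ^ 2 :=
        Finset.sum_congr rfl fun _ _ => Finset.sum_comm
    _ = ∑ f, ∑ e, ∑ p, ∑ r, ‖(M (f, e) * Φ) p r‖ ^ 2 :=
        Finset.sum_congr rfl fun _ _ => Finset.sum_congr rfl fun _ _ => Finset.sum_comm

theorem hsSq_envStack_sub_smul_one (M : F × E → Matrix P P ℂ) (w : F × E → ℂ) (Φ : Matrix P R ℂ) :
    hsSq (envStack M Φ - envStack (fun i => w i • (1 : Matrix P P ℂ)) Φ) =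
      ∑ i, hsSq (M i * Φ - w i • Φ) := by
  have h : envStack M Φ - envStack (fun i => w i • (1 : Matrix P P ℂ)) Φ =
      envStack (fun i => M i - w i • (1 : Matrix P P ℂ)) Φ := by
    ext q t
    simp [envStack, Matrix.sub_mul]
  rw [h, hsSq_envStack]
  refine Finset.sum_congr rfl fun i _ => ?_
  rw [Matrix.sub_mul, Matrix.smul_mul, Matrix.one_mul]

/-- The marginal on `ℂ^E` of the vector `w` in `ℂ^F ⊗ ℂ^E`. -/
def envState (w : F × E → ℂ) : Matrix E E ℂ :=
  Matrix.of fun e e' => ∑ f, w (f, e) * star (w (f, e'))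

theorem envStack_smul_one_apply (w : F × E → ℂ) (Φ : Matrix P R ℂ) (q : R × E) (t : P × F) :
    envStack (fun i => w i • (1 : Matrix P P ℂ)) Φ q t = w (t.2, q.2) * Φ t.1 q.1 := by
  simp [envStack]

theorem envStack_smul_one_mul_conjTranspose (w : F × E → ℂ) (Φ Ψ : Matrix P R ℂ) :
    envStack (fun i => w i • (1 : Matrix P P ℂ)) Φ *
      (envStack (fun i => w i • (1 : Matrix P P ℂ)) Ψ)ᴴ =
      Matrix.kroneckerMap (· * ·) (Φᵀ * Ψᵀᴴ) (envState w) := by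
  ext q q'
  simp only [Matrix.mul_apply, envStack_smul_one_apply, Matrix.conjTranspose_apply,
    Matrix.kroneckerMap_apply, Matrix.transpose_apply, envState, Matrix.of_apply,
    Fintype.sum_prod_type, star_mul']
  rw [Finset.sum_mul_sum]
  exact Finset.sum_congr rfl fun p _ => Finset.sum_congr rfl fun f _ => by ring

theorem traceOutFst_kronecker (X : Matrix R R ℂ) (T : Matrix E E ℂ) :
    traceOutFst (Matrix.kroneckerMap (· * ·) X T) = X.trace • T := by
  ext e e'
  simp [traceOutFst, Matrix.trace, Finset.sum_mul]

theorem traceOutFst_conjTranspose (X : Matrix (R × E) (R × E) ℂ) :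
    traceOutFst Xᴴ = (traceOutFst X)ᴴ := by
  ext e e'
  simp [traceOutFst]

theorem envState_conjTranspose (w : F × E → ℂ) : (envState w)ᴴ = envState w := by
  ext e e'
  simp only [envState, Matrix.conjTranspose_apply, Matrix.of_apply, star_sum, star_mul', star_star]
  exact Finset.sum_congr rfl fun f _ => mul_comm _ _

theorem traceOutFst_envStack_mul (M : F × E → Matrix P P ℂ) (w : F × E → ℂ) (Φ Ψ : Matrix P R ℂ) :
    traceOutFst (envStack M Φ * (envStack (fun i => w i • (1 : Matrix P P ℂ)) Ψ)ᴴ) =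
      Matrix.of fun e e' => ∑ f, (M (f, e) * (Φ * Ψᴴ)).trace * star (w (f, e')) := by
  ext e e'
  have hL : traceOutFst (envStack M Φ * (envStack (fun i => w i • (1 : Matrix P P ℂ)) Ψ)ᴴ) e e' =
      ∑ r, ∑ p, ∑ f, (M (f, e) * Φ) p r * star (Ψ p r) * star (w (f, e')) := by
    refine Finset.sum_congr rfl fun r _ => ?_
    rw [Matrix.mul_apply, Fintype.sum_prod_type]
    refine Finset.sum_congr rfl fun p _ => Finset.sum_congr rfl fun f _ => ?_
    rw [Matrix.conjTranspose_apply, envStack_smul_one_apply, star_mul', mul_comm (star _),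
      ← mul_assoc]
    rfl
  have h : ∀ f, (M (f, e) * (Φ * Ψᴴ)).trace = ∑ r, ∑ p, (M (f, e) * Φ) p r * star (Ψ p r) :=
    fun f => by
      rw [← Matrix.mul_assoc, Matrix.trace, Finset.sum_comm]
      refine Finset.sum_congr rfl fun p _ => ?_
      rw [Matrix.diag_apply, Matrix.mul_apply]
      rfl
  rw [hL, Matrix.of_apply]
  simp only [h, Finset.sum_mul]
  rw [Finset.sum_comm (s := (Finset.univ : Finset F))]
  exact Finset.sum_congr rfl fun r _ => Finset.sum_comm

/-- The cross terms vanish when `w` is the vector of overlaps of the Kraus operators. -/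
theorem traceOutFst_envStack_sub_envState {M : F × E → Matrix P P ℂ} {K : Matrix P R ℂ}
    (hK : hsSq K = 1) {w : F × E → ℂ} (hw : ∀ i, w i = (M i * (K * Kᴴ)).trace) :
    traceOutFst (envStack M K * (envStack M K)ᴴ) - envState w =
      traceOutFst ((envStack M K - envStack (fun i => w i • (1 : Matrix P P ℂ)) K) *
        (envStack M K - envStack (fun i => w i • (1 : Matrix P P ℂ)) K)ᴴ) := by
  have hcross : traceOutFst (envStack M K * (envStack (fun i => w i • (1 : Matrix P P ℂ)) K)ᴴ) =
      envState w := by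
    rw [traceOutFst_envStack_mul]
    simp only [← hw]
    rfl
  have hcross' : traceOutFst (envStack (fun i => w i • (1 : Matrix P P ℂ)) K * (envStack M K)ᴴ) =
      envState w := by
    rw [← envState_conjTranspose, ← hcross, ← traceOutFst_conjTranspose,
      Matrix.conjTranspose_mul, Matrix.conjTranspose_conjTranspose]
  have hdiag : traceOutFst (envStack (fun i => w i • (1 : Matrix P P ℂ)) K *
      (envStack (fun i => w i • (1 : Matrix P P ℂ)) K)ᴴ) = envState w := by
    rw [envStack_smul_one_mul_conjTranspose, traceOutFst_kronecker,
      transpose_mul_transpose_conjTranspose, Matrix.trace_transpose,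
      trace_conjTranspose_mul_self, hK, Complex.ofReal_one, one_smul]
  rw [Matrix.conjTranspose_sub, Matrix.mul_sub, Matrix.sub_mul, Matrix.sub_mul, map_sub, map_sub,
    map_sub, hcross, hcross', hdiag]
  abel

end EnvStack

/-! ### Entanglement fidelity. -/

section EntanglementFidelity

variable {P I R : Type*} [Fintype P] [DecidableEq P] [Fintype I] [Fintype R] [DecidableEq R]

/-- The entanglement fidelity of a channel that is close to the identity. -/
theorem le_sum_norm_trace_sq_of_diamondNorm_le {d : ℕ} {M : I → Matrix (Fin d) (Fin d) ℂ}
    (hM : ∑ i, (M i)ᴴ * M i = 1) {δ : ℝ≥0}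
    (hδ : diamondNorm (krausMap M - LinearMap.id) ≤ δ) {ρ : Matrix (Fin d) (Fin d) ℂ}
    (hρ : IsDensity ρ) : (1 - δ / 2 : ℝ) ≤ ∑ i, ‖(M i * ρ).trace‖ ^ 2 := by
  obtain ⟨K, hK, rfl⟩ := hρ.exists_eq_mul_conjTranspose
  have hnear := traceNorm_idTensor_ketBra_le_of_kDiamondNorm_le ((le_iSup _ d).trans hδ) hK
  rw [idTensor_sub_apply, idTensor_id_apply, idTensor_krausMap_ketBra] at hnear
  set v : Matrix (Fin d × Fin d) Unit ℂ := Matrix.of fun p _ => K p.2 p.1 with hv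
  set X := krausStack M K with hX
  have hvv : ketBra K K = v * vᴴ := ketBra_eq_mul_conjTranspose K K
  have hv1 : vᴴ * v = 1 := by
    ext i j
    have h := trace_conjTranspose_mul_self v
    have hs : hsSq v = 1 := by
      rw [← hK]
      simp only [hsSq, hv, Matrix.of_apply, Fintype.sum_prod_type, Finset.univ_unique,
        Finset.sum_singleton]
      exact Finset.sum_comm
    rw [hs, Matrix.trace, Fintype.sum_unique] at h
    simpa using h
  -- Testing with this reflection yields `2 - 2F ≤ δ`, where `F` is the fidelity; testing with the
  -- projection `v * vᴴ` alone would give only `1 - F ≤ δ`.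
  have hW : IsContraction (1 - (2 : ℂ) • (v * vᴴ)) := by
    refine isContraction_of_isometry ?_
    have h1 : v * vᴴ * (v * vᴴ) = v * vᴴ := by
      rw [Matrix.mul_assoc, ← Matrix.mul_assoc vᴴ, hv1, Matrix.one_mul]
    simp only [Matrix.conjTranspose_sub, Matrix.conjTranspose_one, Matrix.conjTranspose_smul,
      Matrix.conjTranspose_mul, Matrix.conjTranspose_conjTranspose, Matrix.mul_sub, Matrix.sub_mul,
      Matrix.mul_one, Matrix.one_mul, Matrix.smul_mul, Matrix.mul_smul, h1, star_ofNat]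
    module
  have hle := (Complex.re_le_norm _).trans ((norm_trace_mul_le_traceNorm hW _).trans hnear)
  have hfid : (v * vᴴ * (X * Xᴴ)).trace = ((∑ i, ‖(M i * (K * Kᴴ)).trace‖ ^ 2 : ℝ) : ℂ) := by
    have h1 : (v * vᴴ * (X * Xᴴ)).trace = ((Xᴴ * v)ᴴ * (Xᴴ * v)).trace := by
      rw [Matrix.conjTranspose_mul, Matrix.conjTranspose_conjTranspose, Matrix.mul_assoc,
        Matrix.trace_mul_comm]
      simp only [Matrix.mul_assoc]
    rw [h1, trace_conjTranspose_mul_self, hsSq]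
    congr 1
    refine Finset.sum_congr rfl fun i _ => ?_
    rw [Fintype.sum_unique]
    have h2 : (Xᴴ * v) i default = star (M i * (K * Kᴴ)).trace := by
      rw [← Matrix.mul_assoc, Matrix.trace, star_sum, Matrix.mul_apply, Fintype.sum_prod_type,
        Finset.sum_comm]
      refine Finset.sum_congr rfl fun p _ => ?_
      rw [Matrix.diag_apply, Matrix.mul_apply, star_sum]
      refine Finset.sum_congr rfl fun r _ => ?_
      simp [hX, krausStack, hv]
    rw [h2, norm_star]
  have htr : ((1 - (2 : ℂ) • (v * vᴴ)) * (X * Xᴴ - ketBra K K)).trace =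
      ((2 - 2 * ∑ i, ‖(M i * (K * Kᴴ)).trace‖ ^ 2 : ℝ) : ℂ) := by
    have h1 : v * vᴴ * (v * vᴴ) = v * vᴴ := by
      rw [Matrix.mul_assoc, ← Matrix.mul_assoc vᴴ, hv1, Matrix.one_mul]
    have h2 : (X * Xᴴ).trace = 1 := by
      rw [Matrix.trace_mul_comm, trace_conjTranspose_mul_self, hX, hsSq_krausStack,
        sum_hsSq_mul hM, hK, Complex.ofReal_one]
    have h3 : (v * vᴴ).trace = 1 := by
      rw [Matrix.trace_mul_comm, hv1]
      simp
    rw [hvv, Matrix.sub_mul, Matrix.mul_sub, Matrix.mul_sub, Matrix.one_mul, Matrix.one_mul,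
      Matrix.smul_mul, Matrix.smul_mul, h1]
    simp only [Matrix.trace_sub, Matrix.trace_smul, hfid, h2, h3]
    push_cast
    simp only [smul_eq_mul]
    ring
  rw [htr, Complex.ofReal_re] at hle
  linarith

end EntanglementFidelity

/-! ### Decodability implies decoupling on the subspace. -/

section DecouplingOfDecoding

variable {A B E : Type*} [Fintype A] [DecidableEq A] [Fintype B] [DecidableEq B]
  [Fintype E] [DecidableEq E]

/-- An isometry applied to the discarded system does not affect the environment, so the complement
can be computed after the decoder has been dilated. -/
theorem toEnv_mul_conjTranspose_eq_envStack {R P F : Type*} [Fintype R] [Fintype P]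
    [DecidableEq P] [Fintype F] {V : Matrix (B × E) P ℂ} {U : Matrix (P × F) B ℂ}
    (hU : Uᴴ * U = 1) (Φ Ψ : Matrix P R ℂ) :
    toEnv V Φ * (toEnv V Ψ)ᴴ =
      envStack (fun i => envBlock U i.1 * envBlock V i.2) Φ *
        (envStack (fun i => envBlock U i.1 * envBlock V i.2) Ψ)ᴴ := by
  have h : ∀ Θ : Matrix P R ℂ,
      envStack (fun i : F × E => envBlock U i.1 * envBlock V i.2) Θ = toEnv V Θ * Uᵀ := by
    intro Θ
    ext q t
    simp only [envStack, Matrix.of_apply, Matrix.mul_assoc, ← envBlock_mul V]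
    rw [Matrix.mul_apply, Matrix.mul_apply]
    exact Finset.sum_congr rfl fun b _ => mul_comm _ _
  rw [h, h, Matrix.conjTranspose_mul, Matrix.mul_assoc, ← Matrix.mul_assoc Uᵀ,
    transpose_mul_transpose_conjTranspose, hU, Matrix.transpose_one, Matrix.one_mul]

/-- Kraus operators of large entanglement fidelity are close to the multiples of the identity given
by the point of minimal norm of the set of their overlap vectors. -/
theorem exists_isDensity_sum_hsSq_le {d : ℕ} [NeZero d] {I : Type*} [Fintype I]
    {M : I → Matrix (Fin d) (Fin d) ℂ} (hM : ∑ i, (M i)ᴴ * M i = 1) {δ : ℝ≥0}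
    (hδ : diamondNorm (krausMap M - LinearMap.id) ≤ δ) :
    ∃ (K : Matrix (Fin d) (Fin d) ℂ) (w : I → ℂ), hsSq K = 1 ∧
      (∀ i, w i = (M i * (K * Kᴴ)).trace) ∧ ∑ i, ‖w i‖ ^ 2 ≤ 1 ∧
      ∀ {n : ℕ} (Θ : Matrix (Fin d) (Fin n) ℂ),
        ∑ i, hsSq (M i * Θ - w i • Θ) ≤ δ / 2 * hsSq Θ := by
  obtain ⟨ρ₁, hρ₁, hmin⟩ := exists_isDensity_forall_le_inner M
  obtain ⟨K, hK, rfl⟩ := hρ₁.exists_eq_mul_conjTranspose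
  set w := fun i => (M i * (K * Kᴴ)).trace with hw
  set s : ℝ := ∑ i, ‖w i‖ ^ 2 with hs
  have hs_ge : (1 - δ / 2 : ℝ) ≤ s := le_sum_norm_trace_sq_of_diamondNorm_le hM hδ hρ₁
  -- By minimality of `w` the overlap term is at least `s * hsSq Θ`, and `(1 + s) - 2 s = 1 - s ≤ δ
  -- / 2`.
  have hdist : ∀ {n : ℕ} (Θ : Matrix (Fin d) (Fin n) ℂ),
      ∑ i, hsSq (M i * Θ - w i • Θ) ≤ (1 - s) * hsSq Θ := by
    intro n Θ
    rw [sum_hsSq_mul_sub_smul hM]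
    have h1 : s * hsSq Θ ≤ ((∑ i, star (w i) • M i) * (Θ * Θᴴ)).trace.re := by
      refine mul_hsSq_le_of_forall_isDensity (fun ρ hρ => ?_) Θ
      rw [Matrix.sum_mul, Matrix.trace_sum]
      simp only [Matrix.smul_mul, Matrix.trace_smul, smul_eq_mul]
      exact hmin ρ hρ
    rw [Matrix.sum_mul, Matrix.trace_sum] at h1
    simp only [Matrix.smul_mul, Matrix.trace_smul, smul_eq_mul] at h1
    linarith
  refine ⟨K, w, hK, fun _ => rfl, ?_, fun Θ => (hdist Θ).trans
    (mul_le_mul_of_nonneg_right (by linarith) (hsSq_nonneg _))⟩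
  -- `∑ i, ‖w i‖² ≤ 1` follows because a sum of squares is at most `1 - s`.
  have h1 := hdist K
  have h2 : 0 ≤ ∑ i, hsSq (M i * K - w i • K) := Finset.sum_nonneg fun i _ => hsSq_nonneg _
  rw [hK] at h1
  linarith

/-- Replacing `M` by `w` on each side in turn costs `√(δ/2)`, and `2√(δ/2) = √2 √δ`. -/
theorem traceNorm_envStack_sub_kronecker_le {R P F : Type*} [Fintype R] [DecidableEq R]
    [Fintype P] [DecidableEq P] [Fintype F] {M : F × E → Matrix P P ℂ}
    (hM : ∑ i, (M i)ᴴ * M i = 1) {w : F × E → ℂ} (hw : ∑ i, ‖w i‖ ^ 2 ≤ 1) {δ : ℝ≥0}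
    (hdist : ∀ Θ : Matrix P R ℂ, ∑ i, hsSq (M i * Θ - w i • Θ) ≤ δ / 2 * hsSq Θ)
    (Φ Ψ : Matrix P R ℂ) :
    traceNorm (envStack M Φ * (envStack M Ψ)ᴴ -
      Matrix.kroneckerMap (· * ·) (Φᵀ * Ψᵀᴴ) (envState w)) ≤
        √2 * √δ * (√(hsSq Φ) * √(hsSq Ψ)) := by
  have hstack : ∀ Θ : Matrix P R ℂ,
      √(hsSq (envStack M Θ - envStack (fun i => w i • (1 : Matrix P P ℂ)) Θ)) ≤
        √(δ / 2) * √(hsSq Θ) := by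
    intro Θ
    rw [← Real.sqrt_mul (by positivity), hsSq_envStack_sub_smul_one]
    exact Real.sqrt_le_sqrt (hdist Θ)
  rw [← envStack_smul_one_mul_conjTranspose]
  refine (traceNorm_mul_conjTranspose_sub_le _ _ _ _).trans ?_
  have hn1 : √(hsSq (envStack M Ψ)) = √(hsSq Ψ) := by
    rw [hsSq_envStack, sum_hsSq_mul hM]
  have hn2 : √(hsSq (envStack (fun i => w i • (1 : Matrix P P ℂ)) Φ)) ≤ √(hsSq Φ) := by
    refine Real.sqrt_le_sqrt ?_
    rw [hsSq_envStack]
    simp only [Matrix.smul_mul, Matrix.one_mul, hsSq_smul]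
    rw [← Finset.sum_mul]
    exact mul_le_of_le_one_left (hsSq_nonneg _) hw
  have h2 : √(δ / 2 : ℝ) * 2 = √2 * √δ := by
    rw [Real.sqrt_div' _ (by norm_num), div_mul_eq_mul_div, div_eq_iff (by positivity)]
    linear_combination (-√(δ : ℝ)) * (Real.mul_self_sqrt (show (0 : ℝ) ≤ 2 by norm_num))
  calc _ ≤ √(δ / 2) * √(hsSq Φ) * √(hsSq Ψ) + √(hsSq Φ) * (√(δ / 2) * √(hsSq Ψ)) := by
        rw [hn1]
        exact add_le_add (mul_le_mul_of_nonneg_right (hstack Φ) (Real.sqrt_nonneg _))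
          (mul_le_mul hn2 (hstack Ψ) (Real.sqrt_nonneg _) (Real.sqrt_nonneg _))
    _ = _ := by
        rw [← h2]
        ring

/-- A decodable subspace is decoupled from the environment. -/
theorem DecodableWithError.exists_decoupled {N : Superop A B} {V : Matrix (B × E) A ℂ}
    (hV : IsIsometricExtension V N) {S : Submodule ℂ (EuclideanSpace ℂ A)} (hS : S ≠ ⊥) {δ : ℝ≥0}
    (hdec : DecodableWithError N S δ) :
    ∃ (ω : Matrix E E ℂ) (ρ₀ : Matrix A A ℂ), IsDensity ρ₀ ∧
      traceNorm (complementary V ρ₀ - ω) ≤ δ / 2 ∧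
      ∀ (n : ℕ) (Φ Ψ : Matrix A (Fin n) ℂ), (∀ r, WithLp.toLp 2 (fun a => Φ a r) ∈ S) →
        (∀ r, WithLp.toLp 2 (fun a => Ψ a r) ∈ S) →
        traceNorm (idTensor (Fin n) (complementary V - constantTo ω) (ketBra Φ Ψ)) ≤
          √2 * √δ * (√(hsSq Φ) * √(hsSq Ψ)) := by
  obtain ⟨D, hD, hδ⟩ := hdec
  have hpos : 0 < Module.finrank ℂ S := Module.finrank_pos_iff.2
    ((Submodule.nontrivial_iff_ne_bot).2 hS)
  have : NeZero (Module.finrank ℂ S) := ⟨hpos.ne'⟩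
  obtain ⟨U, hU⟩ := hD.exists_isIsometricExtension
  set J := inclusionMatrix S with hJdef
  have hJ : Jᴴ * J = 1 := inclusionMatrix_isometry S
  have hVJ : ∑ e, (envBlock (V * J) e)ᴴ * envBlock (V * J) e = 1 := by
    rw [sum_envBlock_conjTranspose_mul, Matrix.conjTranspose_mul, Matrix.mul_assoc,
      ← Matrix.mul_assoc Vᴴ, hV.isometry, Matrix.one_mul, hJ]
  have hUU : ∑ f, (envBlock U f)ᴴ * envBlock U f = 1 := by
    rw [sum_envBlock_conjTranspose_mul, hU.isometry]
  have hcomp : D ∘ₗ restrictTo N S =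
      krausMap fun i : _ × E => envBlock U i.1 * envBlock (V * J) i.2 := by
    rw [restrictTo, hV.eq_krausMap, hU.eq_krausMap, krausMap_comp_conjBy, krausMap_comp]
    rfl
  rw [hcomp] at hδ
  have hM := sum_conjTranspose_mul_comp hUU hVJ
  obtain ⟨K, w, hK, hw, hw1, hdist⟩ := exists_isDensity_sum_hsSq_le hM hδ
  have hToEnv : ∀ {n : ℕ} (Θ : Matrix (Fin (Module.finrank ℂ S)) (Fin n) ℂ),
      toEnv V (J * Θ) = toEnv (V * J) Θ := fun Θ => by simp only [toEnv, Matrix.mul_assoc]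
  -- `ω` has trace at most one and need not be a state. Taking for `ρ₀` the state that defines `w`
  -- makes the cross terms vanish, so the second bound is of order `δ` instead of `√δ`.
  refine ⟨envState w, (J * K) * (J * K)ᴴ, ?_, ?_, ?_⟩
  · exact isDensity_mul_conjTranspose (by rw [hsSq_mul_of_isometry hJ, hK])
  · rw [← traceOutFst_idTensor_ketBra, idTensor_complementary_ketBra, hToEnv,
      toEnv_mul_conjTranspose_eq_envStack hU.isometry, traceOutFst_envStack_sub_envState hK hw]
    refine (traceNorm_traceOutFst_le _).trans ((traceNorm_mul_conjTranspose_le _ _).trans ?_)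
    rw [Real.mul_self_sqrt (hsSq_nonneg _), hsSq_envStack_sub_smul_one]
    refine (hdist K).trans_eq ?_
    rw [hK, mul_one]
  · intro n Φ Ψ hΦ hΨ
    rw [← inclusionMatrix_mul_conjTranspose_mul S hΦ, ← inclusionMatrix_mul_conjTranspose_mul S hΨ,
      ← hJdef, hsSq_mul_of_isometry hJ, hsSq_mul_of_isometry hJ]
    generalize Jᴴ * Φ = Φ'
    generalize Jᴴ * Ψ = Ψ'
    have hgram : (J * Φ')ᵀ * (J * Ψ')ᵀᴴ = Φ'ᵀ * Ψ'ᵀᴴ := by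
      rw [transpose_mul_transpose_conjTranspose, transpose_mul_transpose_conjTranspose,
        Matrix.conjTranspose_mul, Matrix.mul_assoc, ← Matrix.mul_assoc Jᴴ, hJ, Matrix.one_mul]
    rw [idTensor_sub_apply, idTensor_complementary_ketBra, idTensor_constantTo_ketBra, hgram,
      hToEnv, hToEnv, toEnv_mul_conjTranspose_eq_envStack hU.isometry]
    exact traceNorm_envStack_sub_kronecker_le hM hw1 hdist _ _

end DecouplingOfDecoding

/-! ### Singular value decomposition. -/

section SingularVectors

variable {n : Type*} [Fintype n] [DecidableEq n]

/-- Singular value decomposition: a square matrix becomes diagonal in suitable orthonormal bases. -/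
theorem exists_unitary_mul_mul_eq_zero (M : Matrix n n ℂ) :
    ∃ Y Z : Matrix n n ℂ, Y * Yᴴ = 1 ∧ Z * Zᴴ = 1 ∧ ∀ i j, i ≠ j → (Yᴴ * M * Z) i j = 0 := by
  set Z : Matrix n n ℂ :=
    ((Matrix.isHermitian_conjTranspose_mul_self M).eigenvectorUnitary : Matrix n n ℂ) with hZ
  have hQ : (M * Z)ᴴ * (M * Z) = _ := conjTranspose_mul_self_eigenvectorUnitary M
  set Q := M * Z with hQdef
  let q : n → EuclideanSpace ℂ n := fun j => WithLp.toLp 2 fun a => Q a j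
  have hinner : ∀ i j, inner ℂ (q i) (q j) = (Qᴴ * Q) i j := by
    intro i j
    rw [EuclideanSpace.inner_eq_star_dotProduct, Matrix.mul_apply, dotProduct]
    exact Finset.sum_congr rfl fun a _ => mul_comm _ _
  have horth : ∀ i j, i ≠ j → inner ℂ (q i) (q j) = 0 := by
    intro i j hij
    rw [hinner, hQ, Matrix.diagonal_apply_ne _ hij]
  let v : n → EuclideanSpace ℂ n := fun j => ((‖q j‖ : ℂ)⁻¹) • q j
  -- Only the nonzero columns can be normalized; the resulting orthonormal family is then extended
  -- to a basis.
  have hv : Orthonormal ℂ (Set.domRestrict {j | q j ≠ 0} v) := by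
    refine ⟨fun j => ?_, fun i j hij => ?_⟩
    · have : ‖q j‖ ≠ 0 := norm_ne_zero_iff.2 j.2
      change ‖((‖q j‖ : ℂ)⁻¹) • q j‖ = 1
      rw [norm_smul, norm_inv, Complex.norm_real, norm_norm, inv_mul_cancel₀ this]
    · have h : (i : n) ≠ j := fun h => hij (Subtype.ext h)
      change inner ℂ (((‖q i‖ : ℂ)⁻¹) • q i) (((‖q j‖ : ℂ)⁻¹) • q j) = 0
      rw [inner_smul_left, inner_smul_right, horth _ _ h, mul_zero, mul_zero]
  obtain ⟨b, hb⟩ := hv.exists_orthonormalBasis_extension_of_card_eq (by simp)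
  have hqb : ∀ j, q j = (‖q j‖ : ℂ) • b j := by
    intro j
    by_cases hj : q j = 0
    · simp [hj]
    · rw [hb j hj]
      simp only [v]
      rw [smul_smul, mul_inv_cancel₀ (by exact_mod_cast norm_ne_zero_iff.2 hj), one_smul]
  let Y : Matrix n n ℂ := Matrix.of fun a i => b i a
  have hYY : Yᴴ * Y = 1 := by
    ext i j
    have h := orthonormal_iff_ite.1 b.orthonormal i j
    rw [EuclideanSpace.inner_eq_star_dotProduct] at h
    rw [Matrix.one_apply, ← h, Matrix.mul_apply, dotProduct]
    exact Finset.sum_congr rfl fun a _ => mul_comm _ _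
  refine ⟨Y, Z, mul_eq_one_comm.1 hYY, Unitary.coe_mul_star_self _, fun i j hij => ?_⟩
  rw [Matrix.mul_assoc, ← hQdef]
  have h : (Yᴴ * Q) i j = inner ℂ (b i) (q j) := by
    rw [EuclideanSpace.inner_eq_star_dotProduct, Matrix.mul_apply, dotProduct]
    exact Finset.sum_congr rfl fun a _ => mul_comm _ _
  rw [h, hqb, inner_smul_right, orthonormal_iff_ite.1 b.orthonormal i j, if_neg hij, mul_zero]

end SingularVectors

/-! ### Cutting a vector along a colouring of a reference basis. -/

section Masks

variable {A n κ : Type*} [Fintype A] [Fintype n] [DecidableEq n] [DecidableEq κ]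

/-- The coordinate projection onto the class `x` of the colouring `c`. -/
def classProj (c : n → κ) (x : κ) : Matrix n n ℂ :=
  Matrix.diagonal fun i => if c i = x then 1 else 0

theorem classProj_conjTranspose (c : n → κ) (x : κ) : (classProj c x)ᴴ = classProj c x := by
  rw [classProj, Matrix.diagonal_conjTranspose]
  congr 1
  ext i
  simp [apply_ite star]

theorem sum_classProj [Fintype κ] (c : n → κ) : ∑ x, classProj c x = 1 := by
  ext i j
  simp only [classProj, Matrix.sum_apply, Matrix.diagonal_apply, Matrix.one_apply]
  by_cases h : i = j <;> simp [h]

theorem sum_hsSq_mul_classProj [Fintype κ] (c : n → κ) (X : Matrix A n ℂ) :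
    ∑ x, hsSq (X * classProj c x) = hsSq X := by
  simp only [hsSq, classProj, Matrix.mul_diagonal]
  rw [Finset.sum_comm]
  refine Finset.sum_congr rfl fun a _ => ?_
  rw [Finset.sum_comm]
  refine Finset.sum_congr rfl fun i _ => ?_
  rw [Finset.sum_eq_single (c i) (fun x _ hx => by simp [hx.symm]) (by simp)]
  simp

theorem hsSq_mul_conjTranspose_unitary {Z : Matrix n n ℂ} (hZ : Z * Zᴴ = 1) (X : Matrix A n ℂ) :
    hsSq (X * Zᴴ) = hsSq X := by
  rw [← hsSq_conjTranspose, Matrix.conjTranspose_mul, Matrix.conjTranspose_conjTranspose,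
    hsSq_mul_of_isometry (mul_eq_one_comm.1 hZ), hsSq_conjTranspose]

theorem hsSq_mul_unitary {Z : Matrix n n ℂ} (hZ : Z * Zᴴ = 1) (X : Matrix A n ℂ) :
    hsSq (X * Z) = hsSq X := by
  have h : Zᴴ * Zᴴᴴ = 1 := by rw [Matrix.conjTranspose_conjTranspose, mul_eq_one_comm.1 hZ]
  simpa using hsSq_mul_conjTranspose_unitary h X

/-- The part of `Φ` supported, in the orthonormal basis given by `Z`, on the class `x`. -/
def classPart (Z : Matrix n n ℂ) (c : n → κ) (Φ : Matrix A n ℂ) (x : κ) : Matrix A n ℂ :=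
  Φ * Z * classProj c x * Zᴴ

theorem sum_classPart [Fintype κ] {Z : Matrix n n ℂ} (hZ : Z * Zᴴ = 1) (c : n → κ)
    (Φ : Matrix A n ℂ) :
    ∑ x, classPart Z c Φ x = Φ := by
  simp only [classPart]
  rw [← Matrix.sum_mul, ← Matrix.mul_sum, sum_classProj, Matrix.mul_one, Matrix.mul_assoc, hZ,
    Matrix.mul_one]

theorem sum_hsSq_classPart [Fintype κ] {Z : Matrix n n ℂ} (hZ : Z * Zᴴ = 1) (c : n → κ)
    (Φ : Matrix A n ℂ) :
    ∑ x, hsSq (classPart Z c Φ x) = hsSq Φ := by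
  simp only [classPart, hsSq_mul_conjTranspose_unitary hZ]
  rw [sum_hsSq_mul_classProj, hsSq_mul_unitary hZ]

/-- The parts are orthogonal, so Cauchy–Schwarz costs only the root of the number of classes. -/
theorem sum_sqrt_hsSq_classPart_le [Fintype κ] {Z : Matrix n n ℂ} (hZ : Z * Zᴴ = 1) (c : n → κ)
    (Φ : Matrix A n ℂ) :
    ∑ x, √(hsSq (classPart Z c Φ x)) ≤ √(Fintype.card κ) * √(hsSq Φ) := by
  have h := Real.sum_mul_le_sqrt_mul_sqrt Finset.univ (fun _ : κ => (1 : ℝ))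
    fun x => √(hsSq (classPart Z c Φ x))
  simp only [one_mul, one_pow, Finset.sum_const, Finset.card_univ, nsmul_eq_mul, mul_one,
    Real.sq_sqrt (hsSq_nonneg _), sum_hsSq_classPart hZ] at h
  exact h

/-- Pairing only equal classes costs no factor, in contrast to a sum over all pairs. -/
theorem sum_sqrt_hsSq_mul_sqrt_hsSq_classPart_le [Fintype κ] {Y Z : Matrix n n ℂ} (hY : Y * Yᴴ = 1)
    (hZ : Z * Zᴴ = 1) (c : n → κ) (Φ Ψ : Matrix A n ℂ) :
    ∑ x, √(hsSq (classPart Z c Φ x)) * √(hsSq (classPart Y c Ψ x)) ≤ √(hsSq Φ) * √(hsSq Ψ) := by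
  refine (Real.sum_mul_le_sqrt_mul_sqrt _ _ _).trans_eq ?_
  simp only [Real.sq_sqrt (hsSq_nonneg _), sum_hsSq_classPart hZ, sum_hsSq_classPart hY]

theorem classPart_conjTranspose_mul {κ' : Type*} [DecidableEq κ'] (Y Z : Matrix n n ℂ)
    (Φ Ψ : Matrix A n ℂ) (c : n → κ) (c' : n → κ') (x : κ) (y : κ') :
    (classPart Y c' Ψ y)ᴴ * classPart Z c Φ x =
      Y * (classProj c' y * (Yᴴ * (Ψᴴ * Φ) * Z) * classProj c x) * Zᴴ := by
  simp only [classPart, Matrix.conjTranspose_mul, Matrix.conjTranspose_conjTranspose,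
    classProj_conjTranspose, Matrix.mul_assoc]

/-- In singular bases `Ψᴴ * Φ` is diagonal, so a row class and a column class meet only in their
common indices. The Gram matrix of the two large parts is thus that of two smaller parts of one
joint class. -/
theorem classPart_conjTranspose_mul_classPart {κ' : Type*} [DecidableEq κ']
    {Y Z : Matrix n n ℂ} {Φ Ψ : Matrix A n ℂ} (h : ∀ i j, i ≠ j → (Yᴴ * (Ψᴴ * Φ) * Z) i j = 0)
    (c : n → κ) (c' : n → κ') (x : κ) (y : κ') :
    (classPart Y c' Ψ y)ᴴ * classPart Z c Φ x =
      (classPart Y (fun i => (c i, c' i)) Ψ (x, y))ᴴ *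
        classPart Z (fun i => (c i, c' i)) Φ (x, y) := by
  rw [classPart_conjTranspose_mul, classPart_conjTranspose_mul]
  congr 2
  ext i j
  simp only [classProj, Matrix.diagonal_mul, Matrix.mul_diagonal, Prod.mk.injEq]
  by_cases hij : i = j
  · subst hij
    by_cases h1 : c i = x <;> by_cases h2 : c' i = y <;> simp [h1, h2]
  · simp [h i j hij]

/-- The span of the columns of `Φ * Z` indexed by the class `x`. -/
def classSpan (Z : Matrix n n ℂ) (c : n → κ) (Φ : Matrix A n ℂ) (x : κ) :
    Submodule ℂ (EuclideanSpace ℂ A) :=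
  Submodule.span ℂ (Set.range fun i : {i // c i = x} => WithLp.toLp 2 fun a => (Φ * Z) a i)

theorem finrank_classSpan_le (Z : Matrix n n ℂ) (c : n → κ) (Φ : Matrix A n ℂ) (x : κ) :
    Module.finrank ℂ (classSpan Z c Φ x) ≤ (Finset.univ.filter fun i => c i = x).card :=
  (finrank_range_le_card _).trans_eq (Fintype.card_subtype _)

theorem classPart_mem_classSpan (Z : Matrix n n ℂ) (c : n → κ) (Φ : Matrix A n ℂ) (x : κ) (r : n) :
    WithLp.toLp 2 (fun a => classPart Z c Φ x a r) ∈ classSpan Z c Φ x := by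
  have h : (WithLp.toLp 2 (fun a => classPart Z c Φ x a r) : EuclideanSpace ℂ A) =
      ∑ i ∈ Finset.univ.filter (fun i => c i = x),
        star (Z r i) • (WithLp.toLp 2 fun a => (Φ * Z) a i : EuclideanSpace ℂ A) := by
    ext a
    simp only [classPart, classProj, Matrix.mul_apply (N := Zᴴ), Matrix.mul_diagonal,
      Matrix.conjTranspose_apply, WithLp.ofLp_sum, Finset.sum_apply, Finset.sum_filter]
    refine Finset.sum_congr rfl fun i _ => ?_
    by_cases hi : c i = x <;> simp [hi, mul_comm]
  rw [h]
  refine Submodule.sum_mem _ fun i hi => Submodule.smul_mem _ _ (Submodule.subset_span ?_)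
  exact ⟨⟨i, (Finset.mem_filter.1 hi).2⟩, rfl⟩

theorem exists_coloring {k r g : ℕ} (hg : 0 < g) (hk : k ≤ r * g) :
    ∃ c : Fin k → Fin r, ∀ x, (Finset.univ.filter fun i => c i = x).card ≤ g := by
  -- Classes are consecutive blocks of length `g`, on each of which the residue modulo `g` is
  -- injective.
  refine ⟨fun i => ⟨i / g, Nat.div_lt_of_lt_mul (by rw [mul_comm]; omega)⟩, fun x => ?_⟩
  refine (Finset.card_le_card_of_injOn (t := Finset.range g) (fun i : Fin k => (i : ℕ) % g)
    (fun i _ => by simpa using Nat.mod_lt _ hg) ?_).trans_eq (Finset.card_range g)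
  intro i hi j hj hij
  simp only [Finset.coe_filter, Finset.mem_univ, true_and, Set.mem_ofPred_eq, Fin.ext_iff]
    at hi hj hij
  refine Fin.ext ?_
  rw [← Nat.div_add_mod (i : ℕ) g, ← Nat.div_add_mod (j : ℕ) g, hij, hi, hj]

end Masks

/-! ### From decodable subspaces to forgetfulness. -/

section ForgetfulOfDecoding

variable {A B E : Type*} [Fintype A] [DecidableEq A] [Fintype B] [DecidableEq B]
  [Fintype E] [DecidableEq E]

theorem constantTo_apply (σ : Matrix E E ℂ) (X : Matrix A A ℂ) :
    constantTo σ X = X.trace • σ := rfl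

theorem traceNorm_complementary_sub_smul_le {V : Matrix (B × E) A ℂ} {ω : Matrix E E ℂ} {n : ℕ}
    {Φ : Matrix A (Fin n) ℂ} {c : ℝ}
    (h : traceNorm (idTensor (Fin n) (complementary V - constantTo ω) (ketBra Φ Φ)) ≤
      c * (√(hsSq Φ) * √(hsSq Φ))) :
    traceNorm (complementary V (Φ * Φᴴ) - (hsSq Φ : ℂ) • ω) ≤ c * hsSq Φ := by
  have h1 := (traceNorm_traceOutFst_le _).trans h
  rw [traceOutFst_idTensor_ketBra, LinearMap.sub_apply, constantTo_apply, Matrix.trace_mul_comm,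
    trace_conjTranspose_mul_self, Real.mul_self_sqrt (hsSq_nonneg _)] at h1
  exact h1

/-- The complementary channel hardly distinguishes pure states if two-dimensional subspaces are
decodable. -/
theorem traceNorm_complementary_sub_smul_complementary_le {N : Superop A B}
    {V : Matrix (B × E) A ℂ} (hV : IsIsometricExtension V N) {δ : ℝ≥0}
    (hdec : ∀ S : Submodule ℂ (EuclideanSpace ℂ A), S ≠ ⊥ → Module.finrank ℂ S ≤ 2 →
      DecodableWithError N S δ)
    (Φ : Matrix A (Fin 1) ℂ) {α : Matrix A (Fin 1) ℂ} (hα : hsSq α = 1) :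
    traceNorm (complementary V (Φ * Φᴴ) - (hsSq Φ : ℂ) • complementary V (α * αᴴ)) ≤
      2 * (√2 * √δ) * hsSq Φ := by
  classical
  set x : EuclideanSpace ℂ A := WithLp.toLp 2 fun a => Φ a 0 with hx
  set y : EuclideanSpace ℂ A := WithLp.toLp 2 fun a => α a 0 with hy
  -- One subspace containing both vectors, hence one `ω` near both outputs.
  set S : Submodule ℂ (EuclideanSpace ℂ A) := Submodule.span ℂ (({x, y} : Finset _) : Set _) with hS
  have hxS : x ∈ S := Submodule.subset_span (by simp)
  have hyS : y ∈ S := Submodule.subset_span (by simp)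
  have hne : S ≠ ⊥ := by
    intro hbot
    rw [hbot, Submodule.mem_bot] at hyS
    have h0 : α = 0 := by
      ext a i
      rw [Subsingleton.elim i 0]
      exact congrArg (fun z : EuclideanSpace ℂ A => z a) hyS
    rw [h0, hsSq_zero] at hα
    exact zero_ne_one hα
  have hfin : Module.finrank ℂ S ≤ 2 := (finrank_span_finset_le_card _).trans Finset.card_le_two
  obtain ⟨ω, -, -, -, hω⟩ := (hdec S hne hfin).exists_decoupled hV hne
  have hΦS : ∀ r, WithLp.toLp 2 (fun a => Φ a r) ∈ S := fun r => by
    rw [Subsingleton.elim r 0]; exact hxS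
  have hαS : ∀ r, WithLp.toLp 2 (fun a => α a r) ∈ S := fun r => by
    rw [Subsingleton.elim r 0]; exact hyS
  have h1 := traceNorm_complementary_sub_smul_le (hω 1 Φ Φ hΦS hΦS)
  have h2 := traceNorm_complementary_sub_smul_le (hω 1 α α hαS hαS)
  rw [hα, Complex.ofReal_one, one_smul, mul_one] at h2
  have h3 : complementary V (Φ * Φᴴ) - (hsSq Φ : ℂ) • complementary V (α * αᴴ) =
      (complementary V (Φ * Φᴴ) - (hsSq Φ : ℂ) • ω) -
        (hsSq Φ : ℂ) • (complementary V (α * αᴴ) - ω) := by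
    rw [smul_sub]
    abel
  rw [h3]
  refine (traceNorm_sub_le _ _).trans ?_
  have h4 := traceNorm_smul_le (hsSq Φ : ℂ) (complementary V (α * αᴴ) - ω)
  rw [Complex.norm_real, Real.norm_of_nonneg (hsSq_nonneg _)] at h4
  have h5 := mul_le_mul_of_nonneg_left h2 (hsSq_nonneg Φ)
  linarith

/-- The columns of `K` decompose the state into unnormalized pure states of total weight one, so the
pure-state bound extends by convexity. -/
theorem traceNorm_complementary_sub_complementary_le {N : Superop A B}
    {V : Matrix (B × E) A ℂ} (hV : IsIsometricExtension V N) {δ : ℝ≥0}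
    (hdec : ∀ S : Submodule ℂ (EuclideanSpace ℂ A), S ≠ ⊥ → Module.finrank ℂ S ≤ 2 →
      DecodableWithError N S δ)
    {ρ : Matrix A A ℂ} (hρ : IsDensity ρ) {α : Matrix A (Fin 1) ℂ} (hα : hsSq α = 1) :
    traceNorm (complementary V ρ - complementary V (α * αᴴ)) ≤ 2 * (√2 * √δ) := by
  obtain ⟨K, hK, rfl⟩ := hρ.exists_eq_mul_conjTranspose
  set col : A → Matrix A (Fin 1) ℂ := fun j => Matrix.of fun a _ => K a j with hcol
  have hsum : ∑ j, hsSq (col j) = 1 := by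
    rw [← hK]
    simp only [hsSq, hcol, Matrix.of_apply, Finset.univ_unique, Finset.sum_singleton]
    exact Finset.sum_comm
  have hKK : K * Kᴴ = ∑ j, col j * (col j)ᴴ := by
    ext a a'
    simp [hcol, Matrix.mul_apply, Matrix.sum_apply]
  have h : complementary V (K * Kᴴ) - complementary V (α * αᴴ) =
      ∑ j, (complementary V (col j * (col j)ᴴ) -
        (hsSq (col j) : ℂ) • complementary V (α * αᴴ)) := by
    rw [Finset.sum_sub_distrib, ← Finset.sum_smul, ← Complex.ofReal_sum, hsum, Complex.ofReal_one,
      one_smul, hKK, map_sum]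
  rw [h]
  refine (traceNorm_sum_le _ _).trans ?_
  refine (Finset.sum_le_sum fun j _ =>
    traceNorm_complementary_sub_smul_complementary_le hV hdec (col j) hα).trans_eq ?_
  rw [← Finset.mul_sum, hsum, mul_one]

theorem ketBra_zero_left {R : Type*} (Ψ : Matrix A R ℂ) : ketBra 0 Ψ = 0 := by
  ext p q
  simp [ketBra]

/-- Forgetfulness on a decodable subspace, with the contribution of the constant channel estimated
through the partial trace. -/
theorem traceNorm_idTensor_ketBra_le_of_mem {N : Superop A B} {V : Matrix (B × E) A ℂ}
    (hV : IsIsometricExtension V N) {δ : ℝ≥0} {d : ℕ} (hd : 2 ≤ d)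
    (hdec : ∀ S : Submodule ℂ (EuclideanSpace ℂ A), S ≠ ⊥ → Module.finrank ℂ S ≤ d →
      DecodableWithError N S δ)
    {α : Matrix A (Fin 1) ℂ} (hα : hsSq α = 1) {S : Submodule ℂ (EuclideanSpace ℂ A)}
    (hS : Module.finrank ℂ S ≤ d) {n : ℕ} {Φ Ψ Φ' Ψ' : Matrix A (Fin n) ℂ}
    (hΦ : ∀ r, WithLp.toLp 2 (fun a => Φ a r) ∈ S) (hΨ : ∀ r, WithLp.toLp 2 (fun a => Ψ a r) ∈ S)
    (h : Ψᴴ * Φ = Ψ'ᴴ * Φ') :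
    traceNorm (idTensor (Fin n) (complementary V - constantTo (complementary V (α * αᴴ)))
      (ketBra Φ Ψ)) ≤ √2 * √δ * (√(hsSq Φ) * √(hsSq Ψ)) +
        (2 * (√2 * √δ) + δ / 2) * (√(hsSq Φ') * √(hsSq Ψ')) := by
  by_cases hne : S = ⊥
  · have h0 : Φ = 0 := by
      ext a r
      have := hΦ r
      rw [hne, Submodule.mem_bot] at this
      exact congrArg (fun z : EuclideanSpace ℂ A => z a) this
    rw [h0, ketBra_zero_left, map_zero, traceNorm_zero]
    positivity
  · obtain ⟨ω, ρ₀, hρ₀, hωρ, hω⟩ := (hdec S hne hS).exists_decoupled hV hne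
    have h1 := hω n Φ Ψ hΦ hΨ
    set σ := complementary V (α * αᴴ) with hσ
    have h2 : traceNorm (ω - σ) ≤ 2 * (√2 * √δ) + δ / 2 := by
      have h3 := traceNorm_complementary_sub_complementary_le hV
        (fun S h0 hS => hdec S h0 (hS.trans hd)) hρ₀ hα
      rw [traceNorm_sub_comm] at hωρ
      have h4 := traceNorm_add_le (ω - complementary V ρ₀) (complementary V ρ₀ - σ)
      rw [sub_add_sub_cancel] at h4
      linarith
    -- Exchanging `ω` for `σ` changes the output by the Gram matrix tensored with `ω - σ`; the Gram
    -- matrix may be computed from the smaller vectors `Φ'`, `Ψ'`.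
    have h3 : idTensor (Fin n) (complementary V - constantTo σ) (ketBra Φ Ψ) =
        idTensor (Fin n) (complementary V - constantTo ω) (ketBra Φ Ψ) +
          Matrix.kroneckerMap (· * ·) (Φ'ᵀ * Ψ'ᵀᴴ) (ω - σ) := by
      have h4 : Φᵀ * Ψᵀᴴ = Φ'ᵀ * Ψ'ᵀᴴ := by
        rw [transpose_mul_transpose_conjTranspose, transpose_mul_transpose_conjTranspose, h]
      rw [idTensor_sub_apply, idTensor_sub_apply, idTensor_constantTo_ketBra,
        idTensor_constantTo_ketBra, h4]
      ext p q
      simp only [Matrix.sub_apply, Matrix.add_apply, Matrix.kroneckerMap_apply]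
      ring
    rw [h3]
    refine (traceNorm_add_le _ _).trans (add_le_add h1 ?_)
    refine (traceNorm_kronecker_le _ _ _).trans ?_
    rw [hsSq_transpose, hsSq_transpose, mul_comm]
    exact mul_le_mul_of_nonneg_right h2 (by positivity)

theorem ketBra_sum_sum {R κ κ' : Type*} [Fintype κ] [Fintype κ'] (Φ : κ → Matrix A R ℂ)
    (Ψ : κ' → Matrix A R ℂ) :
    ketBra (∑ x, Φ x) (∑ y, Ψ y) = ∑ x, ∑ y, ketBra (Φ x) (Ψ y) := by
  ext p q
  simp only [ketBra, Matrix.of_apply, Matrix.sum_apply, star_sum, Finset.sum_mul_sum]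

/-- The trivial bound, which settles the case of large `δ`. -/
theorem kDiamondNorm_complementary_sub_le_two {V : Matrix (B × E) A ℂ} (hV : Vᴴ * V = 1)
    {ρ : Matrix A A ℂ} (hρ : IsDensity ρ) (k : ℕ) :
    kDiamondNorm k (complementary V - constantTo (complementary V ρ)) ≤ (2 : ℝ≥0) := by
  refine kDiamondNorm_le_of_ketBra fun Φ Ψ => ?_
  obtain ⟨L, hL, hσ⟩ := exists_complementary_eq_mul_conjTranspose hV hρ
  have hσ1 : traceNorm (complementary V ρ) ≤ 1 := by
    rw [hσ]
    exact (traceNorm_mul_conjTranspose_le L L).trans_eq (by simp [hL])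
  rw [idTensor_sub_apply, idTensor_complementary_ketBra, idTensor_constantTo_ketBra]
  refine (traceNorm_sub_le _ _).trans ?_
  have h1 := traceNorm_mul_conjTranspose_le (toEnv V Φ) (toEnv V Ψ)
  rw [hsSq_toEnv hV, hsSq_toEnv hV] at h1
  have h2 := traceNorm_kronecker_le Φᵀ Ψᵀ (complementary V ρ)
  rw [hsSq_transpose, hsSq_transpose] at h2
  have h3 := mul_le_of_le_one_right (a := √(hsSq Φ) * √(hsSq Ψ)) (by positivity) hσ1
  push_cast
  linarith

/-- If subspaces of dimension `⌈k/3⌉ + ⌈k/4⌉` are decodable, the complementary channel is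
`k`-forgetful. -/
theorem exists_kDiamondNorm_le_of_decodable [Nonempty A] {N : Superop A B}
    {V : Matrix (B × E) A ℂ} (hV : IsIsometricExtension V N) {δ : ℝ≥0} {k : ℕ} (hk : 0 < k)
    (hdec : ∀ S : Submodule ℂ (EuclideanSpace ℂ A), S ≠ ⊥ →
      Module.finrank ℂ S ≤ (k + 2) / 3 + (k + 3) / 4 → DecodableWithError N S δ) :
    ∃ ρ : Matrix A A ℂ, IsDensity ρ ∧
      kDiamondNorm k (complementary V - constantTo (complementary V ρ)) ≤
        (8 * NNReal.sqrt δ : ℝ≥0) := by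
  classical
  set α : Matrix A (Fin 1) ℂ :=
    Matrix.of fun a _ => if a = Classical.arbitrary A then 1 else 0 with hαdef
  have hα : hsSq α = 1 := by
    simp [hsSq, hαdef, apply_ite (fun z : ℂ => ‖z‖ ^ 2)]
  have hρ := isDensity_mul_conjTranspose hα
  refine ⟨α * αᴴ, hρ, ?_⟩
  -- At `δ = 1/16` the trivial bound `2` equals `8√δ`. Below it, `δ / 2 ≤ √δ / 8` can be absorbed
  -- into the constant.
  rcases le_total (1 / 16) δ with hδ | hδ
  · refine (kDiamondNorm_complementary_sub_le_two hV.isometry hρ k).trans ?_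
    have h1 : (1 / 4 : ℝ≥0) ≤ NNReal.sqrt δ := by
      rw [NNReal.le_sqrt_iff_sq_le]
      exact le_trans (by norm_num) hδ
    have h2 : (2 : ℝ≥0) ≤ 8 * NNReal.sqrt δ := by
      calc (2 : ℝ≥0) = 8 * (1 / 4) := by norm_num
        _ ≤ _ := by gcongr
    exact_mod_cast h2
  refine kDiamondNorm_le_of_ketBra fun Φ Ψ => ?_
  obtain ⟨Y, Z, hY, hZ, hYZ⟩ := exists_unitary_mul_mul_eq_zero (Ψᴴ * Φ)
  -- Three and four classes keep `⌈k/3⌉ + ⌈k/4⌉` below `k` for all `k ≥ 3`; three and three would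
  -- fail at `k = 4`.
  obtain ⟨c, hc⟩ := exists_coloring (k := k) (r := 3) (g := (k + 2) / 3) (by omega) (by omega)
  obtain ⟨c', hc'⟩ := exists_coloring (k := k) (r := 4) (g := (k + 3) / 4) (by omega) (by omega)
  set Γ := complementary V - constantTo (complementary V (α * αᴴ)) with hΓ
  have hpiece : ∀ x y, traceNorm (idTensor (Fin k) Γ
      (ketBra (classPart Z c Φ x) (classPart Y c' Ψ y))) ≤
      √2 * √δ * (√(hsSq (classPart Z c Φ x)) * √(hsSq (classPart Y c' Ψ y))) +
        (2 * (√2 * √δ) + δ / 2) *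
          (√(hsSq (classPart Z (fun i => (c i, c' i)) Φ (x, y))) *
            √(hsSq (classPart Y (fun i => (c i, c' i)) Ψ (x, y)))) := by
    intro x y
    have hfin : Module.finrank ℂ (classSpan Z c Φ x ⊔ classSpan Y c' Ψ y : Submodule ℂ _) ≤
        (k + 2) / 3 + (k + 3) / 4 :=
      (Submodule.finrank_add_le_finrank_add_finrank _ _).trans (add_le_add
        ((finrank_classSpan_le Z c Φ x).trans (hc x))
        ((finrank_classSpan_le Y c' Ψ y).trans (hc' y)))
    exact traceNorm_idTensor_ketBra_le_of_mem hV (by omega) hdec hα hfin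
      (fun r => Submodule.mem_sup_left (classPart_mem_classSpan Z c Φ x r))
      (fun r => Submodule.mem_sup_right (classPart_mem_classSpan Y c' Ψ y r))
      (classPart_conjTranspose_mul_classPart hYZ c c' x y)
  have hdecomp : ketBra Φ Ψ = ∑ x, ∑ y, ketBra (classPart Z c Φ x) (classPart Y c' Ψ y) := by
    rw [← ketBra_sum_sum, sum_classPart hZ, sum_classPart hY]
  have h1 := sum_sqrt_hsSq_classPart_le hZ c Φ
  have h2 := sum_sqrt_hsSq_classPart_le hY c' Ψ
  have h3 := sum_sqrt_hsSq_mul_sqrt_hsSq_classPart_le hY hZ (fun i => (c i, c' i)) Φ Ψ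
  rw [Fintype.sum_prod_type] at h3
  simp only [Fintype.card_fin, Nat.cast_ofNat] at h1 h2
  have hx0 : 0 ≤ √(δ : ℝ) := Real.sqrt_nonneg _
  have hx1 : √(δ : ℝ) ≤ 1 / 4 := by
    refine Real.sqrt_le_iff.2 ⟨by norm_num, ?_⟩
    have : (δ : ℝ) ≤ ((1 / 16 : ℝ≥0) : ℝ) := by exact_mod_cast hδ
    push_cast at this
    linarith
  have hxx : (δ : ℝ) = √(δ : ℝ) * √(δ : ℝ) := (Real.mul_self_sqrt δ.coe_nonneg).symm
  have hs2 : √(2 : ℝ) ≤ 1.415 := Real.sqrt_le_iff.2 ⟨by norm_num, by norm_num⟩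
  have hs3 : √(3 : ℝ) ≤ 1.733 := Real.sqrt_le_iff.2 ⟨by norm_num, by norm_num⟩
  have hs4 : √(4 : ℝ) ≤ 2 := Real.sqrt_le_iff.2 ⟨by norm_num, by norm_num⟩
  -- Numerically `√2 √12 + 2√2 + 1/8 < 7.9`.
  have hconst : √2 * √(δ : ℝ) * (√3 * √4) + (2 * (√2 * √δ) + δ / 2) ≤ 8 * √(δ : ℝ) := by
    have h4 : √(3 : ℝ) * √4 ≤ 1.733 * 2 := mul_le_mul hs3 hs4 (by positivity) (by norm_num)
    have h5 : √(2 : ℝ) * (√3 * √4) ≤ 1.415 * (1.733 * 2) :=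
      mul_le_mul hs2 h4 (by positivity) (by norm_num)
    nlinarith
  calc traceNorm (idTensor (Fin k) Γ (ketBra Φ Ψ))
      ≤ ∑ x, ∑ y, (√2 * √δ * (√(hsSq (classPart Z c Φ x)) * √(hsSq (classPart Y c' Ψ y))) +
        (2 * (√2 * √δ) + δ / 2) *
          (√(hsSq (classPart Z (fun i => (c i, c' i)) Φ (x, y))) *
            √(hsSq (classPart Y (fun i => (c i, c' i)) Ψ (x, y))))) := by
        rw [hdecomp, map_sum]
        refine (traceNorm_sum_le _ _).trans (Finset.sum_le_sum fun x _ => ?_)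
        rw [map_sum]
        exact (traceNorm_sum_le _ _).trans (Finset.sum_le_sum fun y _ => hpiece x y)
    _ = √2 * √δ * ((∑ x, √(hsSq (classPart Z c Φ x))) * ∑ y, √(hsSq (classPart Y c' Ψ y))) +
        (2 * (√2 * √δ) + δ / 2) * ∑ x, ∑ y,
          (√(hsSq (classPart Z (fun i => (c i, c' i)) Φ (x, y))) *
            √(hsSq (classPart Y (fun i => (c i, c' i)) Ψ (x, y)))) := by
        simp only [Finset.sum_add_distrib, ← Finset.mul_sum, Finset.sum_mul_sum]
    _ ≤ √2 * √δ * ((√3 * √(hsSq Φ)) * (√4 * √(hsSq Ψ))) +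
        (2 * (√2 * √δ) + δ / 2) * (√(hsSq Φ) * √(hsSq Ψ)) := by
        gcongr
    _ = (√2 * √δ * (√3 * √4) + (2 * (√2 * √δ) + δ / 2)) * (√(hsSq Φ) * √(hsSq Ψ)) := by ring
    _ ≤ 8 * √δ * (√(hsSq Φ) * √(hsSq Ψ)) := by gcongr
    _ = _ := by
        push_cast
        rfl

end ForgetfulOfDecoding

theorem theorem2 {A B E : Type*} [Fintype A] [DecidableEq A] [Nonempty A]
    [Fintype B] [DecidableEq B] [Fintype E] [DecidableEq E]
    (N : Superop A B) (hN : IsChannel N)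
    (V : Matrix (B × E) A ℂ) (hV : IsIsometricExtension V N) (k : ℕ) :
    -- a `k`-forgetful complement makes every subspace of dimension at most `k` decodable
    (∀ (ε : ℝ≥0) (ρ : Matrix A A ℂ), IsDensity ρ →
      kDiamondNorm k (complementary V - constantTo (complementary V ρ)) ≤ ε →
      ∀ S : Submodule ℂ (EuclideanSpace ℂ A), S ≠ ⊥ → Module.finrank ℂ S ≤ k →
        DecodableWithError N S (2 * NNReal.sqrt (2 * ε))) ∧
    -- the converse, from subspaces of dimension less than `k`
    (3 ≤ k → ∀ δ : ℝ≥0,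
      (∀ S : Submodule ℂ (EuclideanSpace ℂ A), S ≠ ⊥ → Module.finrank ℂ S < k →
        DecodableWithError N S δ) →
      ∃ ρ : Matrix A A ℂ, IsDensity ρ ∧
        kDiamondNorm k (complementary V - constantTo (complementary V ρ)) ≤
          (8 * NNReal.sqrt δ : ℝ≥0)) ∧
    -- the converse, from subspaces of dimension at most `k`
    (2 ≤ k → ∀ δ : ℝ≥0,
      (∀ S : Submodule ℂ (EuclideanSpace ℂ A), S ≠ ⊥ → Module.finrank ℂ S ≤ k →
        DecodableWithError N S δ) →
      ∃ ρ : Matrix A A ℂ, IsDensity ρ ∧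
        kDiamondNorm k (complementary V - constantTo (complementary V ρ)) ≤
          (8 * NNReal.sqrt δ : ℝ≥0)) := by
  refine ⟨fun ε ρ hρ hε S hS hd => ?_, fun hk δ hdec => ?_, fun hk δ hdec => ?_⟩
  · obtain ⟨D, hD, hle⟩ := decodableWithError_of_kDiamondNorm_le hV hρ hε hS hd
    refine ⟨D, hD, hle.trans ?_⟩
    -- The argument gives the sharper error `2√ε`.
    have h : 2 * NNReal.sqrt ε ≤ 2 * NNReal.sqrt (2 * ε) := by
      gcongr
      exact le_mul_of_one_le_left zero_le one_le_two
    exact_mod_cast h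
  · exact exists_kDiamondNorm_le_of_decodable hV (by omega) fun S hS hd =>
      hdec S hS (by omega)
  -- Here `k = 2` is allowed, because `⌈2/3⌉ + ⌈2/4⌉ = 2` is at most `k` although not below it.
  · exact exists_kDiamondNorm_le_of_decodable hV (by omega) fun S hS hd =>
      hdec S hS (by omega)
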